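/- Let $(X,\mathsf d)$ be a non-empty metric space and let $\mathcal M_+(X)$ be the set of non-negative finite Radon measures on $X$. For $\mu_0,\mu_1\in\mathcal M_+(X)$ let $$\mathsf{He}^2(\mu_0,\mu_1)=\int_X\Big(\sqrt{\tfrac{d\mu_0}{d\eta}}-\sqrt{\tfrac{d\mu_1}{d\eta}}\Big)^2 d\eta,$$ where $\eta\in\mathcal M_+(X)$ is any measure with $\mu_0,\mu_1\ll\eta$ (e.g. $\eta=\mu_0+\mu_1$), and let $$\mathbb W^2(\mu_0,\mu_1)=\inf\Big\{\int_{X\times X}\mathsf d^2\,d\gamma:\ \gamma\in\mathcal M_+(X\times X)\text{ with marginals }\mu_0,\mu_1\Big\}\in[0,+\infty]$$ (with $\inf\emptyset=+\infty$) be the squared $2$-Hellinger distance and the squared $2$-Wasserstein extended distance. Define $$\mathbb W\mathsf{He}(\mu_0,\mu_1)=\inf_{\nu\in\mathcal M_+(X)}\big\{\mathsf{He}^2(\mu_0,\nu)+\mathbb W^2(\nu,\mu_1)\big\}.$$ Let $\mathfrak C[X]$ be the cone on $X$, i.e. the set $X\times[0,+\infty)$ with all the points $(x,0)$ identified to a single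 vertex; $[x,r]$ denotes the class of $(x,r)$. Its topology is that of $X\times[0,+\infty)$ near the points $[x,r]$ with $r>0$, while the sets $\{[x,r]: r\le R\}$, $R>0$, form a fundamental system of neighbourhoods of the vertex. Set $\mathsf r([x,r])=r$, and $\mathsf x([x,r])=x$ if $r>0$, $\mathsf x([x,0])=\bar x$ for a fixed $\bar x\in X$ (whose choice is irrelevant). On $\mathfrak C[X,X]=\mathfrak C[X]^2$, with the product topology, let $\mathsf r_i,\mathsf x_i$ ($i=0,1$) be the compositions of $\mathsf r,\mathsf x$ with the two projections. Let $\mathfrak H^2(\mu_0,\mu_1)$ be the set of $2$-homogeneous couplings, i.e. of the finite non-negative Radon measures $\alpha$ on $\mathfrak C[X,X]$ with $\int(\mathsf r_0^2+\mathsf r_1^2)\,d\alpha<+\infty$ and $(\mathsf x_i)_\sharp(\mathsf r_i^2\alpha)=\mu_i$ for $i=0,1$. For $\mathsf H:\mathfrak C[X,X]\to[0,+\infty]$ proper (not identically $+\infty$), lower semicontinuous and radially $2$-homogeneous ($\mathsf H([x_0,\lambda r_0],[x_1,\lambda r_1])=\lambda^2\mathsf H([x_0,r_0],[x_1,r_1])$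 for all $\lambda>0$) let $$\mathsf{UOT}_{\mathsf H}(\mu_0,\mu_1)=\inf\Big\{\int\mathsf H\,d\alpha:\ \alpha\in\mathfrak H^2(\mu_0,\mu_1)\Big\}.$$ **Proposition.** 1. $\mathbb W\mathsf{He}(\mu_0,\mu_1)<+\infty$ for all $\mu_0,\mu_1\in\mathcal M_+(X)$. 2. If $\mu_i$ is the null measure for some $i\in\{0,1\}$, then $\mathbb W\mathsf{He}(\mu_0,\mu_1)=\mu_{1-i}(X)$, and in both cases $\nu=\mu_1$ realizes the infimum. 3. The formula $$\mathsf H_{\mathbb W\mathsf{He}}([x_0,r_0],[x_1,r_1])=\begin{cases}(r_0-r_1)^2+r_1^2\,\mathsf d^2(x_0,x_1)&\text{if }r_0>0,\\ r_1^2&\text{if }r_0=0,\end{cases}$$ gives a well-defined function $\mathsf H_{\mathbb W\mathsf{He}}:\mathfrak C[X,X]\to[0,+\infty)$, which is proper, lower semicontinuous and radially $2$-homogeneous, and $\mathbb W\mathsf{He}(\mu_0,\mu_1)=\mathsf{UOT}_{\mathsf H_{\mathbb W\mathsf{He}}}(\mu_0,\mu_1)$ for all $\mu_0,\mu_1\in\mathcal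 M_+(X)$. In particular, for all $\mu_0,\mu_1\in\mathcal M_+(X)$ there is $\alpha\in\mathfrak H^2(\mu_0,\mu_1)$ with $\mathbb W\mathsf{He}(\mu_0,\mu_1)=\int_{\mathfrak C[X,X]}\mathsf H_{\mathbb W\mathsf{He}}\,d\alpha$. 4. For all $\mu_0,\mu_1\in\mathcal M_+(X)$ there is $\nu\in\mathcal M_+(X)$ realizing the infimum in the definition of $\mathbb W\mathsf{He}(\mu_0,\mu_1)$. -/

import Mathlib

open MeasureTheory Set Topology
open scoped ENNReal NNReal

noncomputable section

/-! ### Radon measures -/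

/-- Non-negative finite Radon measures: finite Borel measures that are inner regular with respect
to compact sets. -/
structure IsFiniteRadon {α : Type*} [TopologicalSpace α] [MeasurableSpace α]
    (μ : Measure α) : Prop where
  finite : IsFiniteMeasure μ
  innerRegular : μ.InnerRegular

/-- The product `α × β` with the product topology and with the Borel `σ`-algebra of that topology
(on non-separable spaces this may be larger than the product of the Borel `σ`-algebras, which is
the default `σ`-algebra on `α × β`). -/
def BorelProd (α β : Type*) : Type _ := α × β

namespace BorelProd

variable {α β : Type*}

def mk (a : α) (b : β) : BorelProd α β := Prod.mk a b

def fst (z : BorelProd α β) : α := Prod.fst z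

def snd (z : BorelProd α β) : β := Prod.snd z

instance [TopologicalSpace α] [TopologicalSpace β] : TopologicalSpace (BorelProd α β) :=
  inferInstanceAs (TopologicalSpace (α × β))

instance [TopologicalSpace α] [TopologicalSpace β] : MeasurableSpace (BorelProd α β) :=
  borel (BorelProd α β)

instance [TopologicalSpace α] [TopologicalSpace β] : BorelSpace (BorelProd α β) := ⟨rfl⟩

end BorelProd

/-! ### The geometric cone -/

/-- The relation on `X × [0, ∞)` that identifies all the pairs with second component `0`. -/
def coneSetoid (X : Type*) : Setoid (X × ℝ≥0) where
  r p q := (p.1 = q.1 ∧ p.2 = q.2) ∨ (p.2 = 0 ∧ q.2 = 0)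
  iseqv :=
    { refl := fun _ => Or.inl ⟨rfl, rfl⟩
      symm := by
        rintro p q (⟨h, h'⟩ | ⟨h, h'⟩)
        · exact Or.inl ⟨h.symm, h'.symm⟩
        · exact Or.inr ⟨h', h⟩
      trans := by
        rintro p q s (⟨h, h'⟩ | ⟨h, h'⟩) (⟨k, k'⟩ | ⟨k, k'⟩)
        · exact Or.inl ⟨h.trans k, h'.trans k'⟩
        · exact Or.inr ⟨h'.trans k, k'⟩
        · exact Or.inr ⟨h, k'.symm.trans h'⟩
        · exact Or.inr ⟨h, k'⟩ }

/-- The geometric cone on `X`. -/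
def Cone (X : Type*) : Type _ := Quotient (coneSetoid X)

namespace Cone

variable {X : Type*}

/-- The point `[x, r]` of the cone. -/
def mk (x : X) (r : ℝ≥0) : Cone X := Quotient.mk (coneSetoid X) (x, r)

/-- The projection `[x, r] ↦ r`. -/
def radius : Cone X → ℝ≥0 :=
  Quotient.lift (fun p : X × ℝ≥0 => p.2) (by
    rintro p q (⟨_, h⟩ | ⟨h, h'⟩)
    · exact h
    · exact h.trans h'.symm)

/-- The projection `[x, r] ↦ x` if `r > 0`, sending the vertex to a fixed point `xbar`. -/
def pos (xbar : X) : Cone X → X :=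
  Quotient.lift (fun p : X × ℝ≥0 => if 0 < p.2 then p.1 else xbar) (by
    rintro p q (⟨h, h'⟩ | ⟨h, h'⟩)
    · simp only [h, h']
    · simp [h, h'])

/-- The topology of the cone: around `[x, r]` with `r > 0` it is that of `X × [0, ∞)`; the sets
`{radius ≤ R}`, `R > 0`, are a fundamental system of neighbourhoods of the vertex. -/
instance [TopologicalSpace X] : TopologicalSpace (Cone X) where
  IsOpen U := IsOpen {p : X × ℝ≥0 | mk p.1 p.2 ∈ U} ∧
    ((∃ x, mk x 0 ∈ U) → ∃ R : ℝ≥0, 0 < R ∧ ∀ y : Cone X, radius y ≤ R → y ∈ U)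
  isOpen_univ := ⟨by simp, fun _ => ⟨1, one_pos, fun _ _ => mem_univ _⟩⟩
  isOpen_inter := by
    rintro U V ⟨hU, hU'⟩ ⟨hV, hV'⟩
    refine ⟨hU.inter hV, ?_⟩
    rintro ⟨x, hx, hx'⟩
    obtain ⟨R, hR, h⟩ := hU' ⟨x, hx⟩
    obtain ⟨S, hS, k⟩ := hV' ⟨x, hx'⟩
    exact ⟨min R S, lt_min hR hS, fun y hy =>
      ⟨h y (hy.trans (min_le_left _ _)), k y (hy.trans (min_le_right _ _))⟩⟩
  isOpen_sUnion := by
    intro S hS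
    refine ⟨?_, ?_⟩
    · have : {p : X × ℝ≥0 | mk p.1 p.2 ∈ ⋃₀ S} = ⋃ U ∈ S, {p : X × ℝ≥0 | mk p.1 p.2 ∈ U} := by
        ext p
        simp
      rw [this]
      exact isOpen_biUnion fun U hU => (hS U hU).1
    · rintro ⟨x, U, hU, hx⟩
      obtain ⟨R, hR, h⟩ := (hS U hU).2 ⟨x, hx⟩
      exact ⟨R, hR, fun y hy => ⟨U, hU, h y hy⟩⟩

instance [TopologicalSpace X] : MeasurableSpace (Cone X) := borel (Cone X)

instance [TopologicalSpace X] : BorelSpace (Cone X) := ⟨rfl⟩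

end Cone

/-- The product cone. -/
abbrev PCone (X : Type*) : Type _ := BorelProd (Cone X) (Cone X)

/-! ### Unbalanced optimal transport -/

section UOT

variable {X : Type*} [TopologicalSpace X] [MeasurableSpace X]

/-- The first `2`-homogeneous marginal of a measure on the product cone. -/
def homMarginal₀ (xbar : X) (α : Measure (PCone X)) : Measure X :=
  (α.withDensity fun z => (z.fst.radius : ℝ≥0∞) ^ 2).map fun z => z.fst.pos xbar

/-- The second `2`-homogeneous marginal of a measure on the product cone. -/
def homMarginal₁ (xbar : X) (α : Measure (PCone X)) : Measure X :=
  (α.withDensity fun z => (z.snd.radius : ℝ≥0∞) ^ 2).map fun z => z.snd.pos xbar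

/-- The `2`-homogeneous couplings of `μ₀` and `μ₁`: finite Radon measures on the product cone
with finite `2`-radial moment whose `2`-homogeneous marginals are `μ₀` and `μ₁`. -/
def HomCouplings (xbar : X) (μ₀ μ₁ : Measure X) : Set (Measure (PCone X)) :=
  {α | IsFiniteRadon α ∧
    ∫⁻ z, ((z.fst.radius : ℝ≥0∞) ^ 2 + (z.snd.radius : ℝ≥0∞) ^ 2) ∂α < ⊤ ∧
    homMarginal₀ xbar α = μ₀ ∧ homMarginal₁ xbar α = μ₁}

/-- The unbalanced optimal transport cost induced by the cone cost `H`. -/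
def UOT (xbar : X) (H : PCone X → ℝ≥0∞) (μ₀ μ₁ : Measure X) : ℝ≥0∞ :=
  ⨅ α ∈ HomCouplings xbar μ₀ μ₁, ∫⁻ z, H z ∂α

end UOT

/-- A `[0, ∞]`-valued function is proper if it is not identically `∞`. -/
def IsProperCost {X : Type*} (H : PCone X → ℝ≥0∞) : Prop := ∃ z, H z < ⊤

/-- Radial `2`-homogeneity. -/
def IsRadiallyTwoHomogeneous {X : Type*} (H : PCone X → ℝ≥0∞) : Prop :=
  ∀ (x₀ x₁ : X) (r₀ r₁ t : ℝ≥0), 0 < t →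
    H (.mk (.mk x₀ (t * r₀)) (.mk x₁ (t * r₁))) =
      (t : ℝ≥0∞) ^ 2 * H (.mk (.mk x₀ r₀) (.mk x₁ r₁))

/-! ### The Hellinger and Wasserstein distances, and the marginal problem -/

/-- The `2`-Hellinger distance, computed with the dominating measure `μ₀ + μ₁`. -/
def hellinger {X : Type*} [MeasurableSpace X] (μ₀ μ₁ : Measure X) : ℝ≥0∞ :=
  (∫⁻ x, ENNReal.ofReal
    ((√(μ₀.rnDeriv (μ₀ + μ₁) x).toReal - √(μ₁.rnDeriv (μ₀ + μ₁) x).toReal) ^ 2)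
      ∂(μ₀ + μ₁)) ^ (1 / 2 : ℝ)

section Metric

variable {X : Type*} [MetricSpace X] [MeasurableSpace X]

/-- Couplings of `μ₀` and `μ₁`. -/
def Couplings (μ₀ μ₁ : Measure X) : Set (Measure (BorelProd X X)) :=
  {γ | IsFiniteRadon γ ∧ γ.map BorelProd.fst = μ₀ ∧ γ.map BorelProd.snd = μ₁}

/-- The `2`-Wasserstein extended distance; it is `∞` if there are no couplings. -/
def wasserstein (μ₀ μ₁ : Measure X) : ℝ≥0∞ :=
  (⨅ γ ∈ Couplings μ₀ μ₁, ∫⁻ z, edist z.fst z.snd ^ 2 ∂γ) ^ (1 / 2 : ℝ)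

/-- The marginal Hellinger-Wasserstein problem. -/
def WHe (μ₀ μ₁ : Measure X) : ℝ≥0∞ :=
  ⨅ (ν : Measure X) (_ : IsFiniteRadon ν), hellinger μ₀ ν ^ 2 + wasserstein ν μ₁ ^ 2

/-- `ν` realizes the infimum in the definition of `WHe μ₀ μ₁`. -/
def IsWHeMinimizer (μ₀ μ₁ ν : Measure X) : Prop :=
  IsFiniteRadon ν ∧ hellinger μ₀ ν ^ 2 + wasserstein ν μ₁ ^ 2 = WHe μ₀ μ₁

end Metric

/-- `H` is given by the explicit formula for the cone cost of the marginal problem, on all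
representatives of points of the cone. -/
def IsWHeCost {X : Type*} [MetricSpace X] (H : PCone X → ℝ≥0∞) : Prop :=
  ∀ (x₀ x₁ : X) (r₀ r₁ : ℝ≥0),
    H (.mk (.mk x₀ r₀) (.mk x₁ r₁)) = ENNReal.ofReal
      (if 0 < r₀ then ((r₀ : ℝ) - r₁) ^ 2 + (r₁ : ℝ) ^ 2 * dist x₀ x₁ ^ 2 else (r₁ : ℝ) ^ 2)

end

/-! The heart of the matter is the equality with the cone problem; each inequality comes from an
explicit construction.

From a homogeneous coupling `α`, put `ν = y_♯(r₁² α)`, where `y = x₀` if `r₀ > 0` and `y = x₁`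
otherwise. The plan `(y, x₁)_♯(r₁² α)` costs exactly the transport term of the cone cost, and `μ₀ =
y_♯(r₀² α)`, so `hellinger_sq_map_le` bounds the Hellinger term by `∫ (r₀ - r₁)² dα`. This is
`HomCouplings.exists_intermediate`.

Conversely, given `ν` and a plan `γ`, write `μ₀ = tη` and `ν = (1 - t)η` with `η = μ₀ + ν`. Lift
`(x, y)` to `([x, √t(x)], [y, √(1 - t(x))])` with weight `1 / (1 - t(x))`, and add the part of `μ₀`
where `t = 1` (`exists_lift`). The normalization `r₀² + r₁² = 1` fixes the mass at `μ₀(X) + μ₁(X)`,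
so a minimizing sequence has a limit as soon as points live in a compact space. For this, points are
recorded by truncated distances from a sequence whose closure contains a σ-compact set carrying `μ₀
+ μ₁`. Weighted marginals survive in the limit, so positions of positive radius lie almost surely in
the image of that set and can be pulled back to `X`; the cost is controlled by an increasing limit
of continuous functions (`exists_homCoupling_lintegral_le`).

Hence the cone infimum is attained, and the intermediate measure of an optimal `α` is a minimizer.
The null cases only use that a plan forces `ν(X) = μ₁(X)`. -/

noncomputable section

/-! ### Radon measures -/

namespace IsFiniteRadon

variable {α β : Type*} [TopologicalSpace α] [MeasurableSpace α] [TopologicalSpace β]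
  [MeasurableSpace β]

theorem zero : IsFiniteRadon (0 : Measure α) := ⟨inferInstance, inferInstance⟩

theorem add {μ ν : Measure α} (hμ : IsFiniteRadon μ) (hν : IsFiniteRadon ν) :
    IsFiniteRadon (μ + ν) := by
  have := hμ.finite
  have := hν.finite
  have := hμ.innerRegular
  have := hν.innerRegular
  refine ⟨inferInstance, ⟨fun B hB r hr => ?_⟩⟩
  rw [Measure.add_apply] at hr
  -- Splitting `r < a + b` with `a < μ B` and `b < ν B` requires both masses to be nonzero.
  rcases eq_or_ne (μ B) 0 with h0 | h0
  · obtain ⟨K, hKB, hK, h⟩ := hB.exists_lt_isCompact (μ := ν) (by simpa [h0] using hr)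
    exact ⟨K, hKB, hK, h.trans_le (by simp)⟩
  rcases eq_or_ne (ν B) 0 with h1 | h1
  · obtain ⟨K, hKB, hK, h⟩ := hB.exists_lt_isCompact (μ := μ) (by simpa [h1] using hr)
    exact ⟨K, hKB, hK, h.trans_le (by simp)⟩
  obtain ⟨a, ha, b, hb, hab⟩ : ∃ a < μ B, ∃ b < ν B, r < a + b :=
    ENNReal.exists_lt_add_of_lt_add hr h0 h1
  obtain ⟨K, hKB, hK, h⟩ := hB.exists_lt_isCompact (μ := μ) ha
  obtain ⟨L, hLB, hL, k⟩ := hB.exists_lt_isCompact (μ := ν) hb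
  refine ⟨K ∪ L, union_subset hKB hLB, hK.union hL, hab.trans_le ?_⟩
  rw [Measure.add_apply]
  exact add_le_add (h.le.trans (measure_mono subset_union_left))
    (k.le.trans (measure_mono subset_union_right))

theorem finset_sum {ι : Type*} (s : Finset ι) {μ : ι → Measure α}
    (hμ : ∀ i, IsFiniteRadon (μ i)) : IsFiniteRadon (∑ i ∈ s, μ i) := by
  classical
  induction s using Finset.induction_on with
  | empty => simpa using zero
  | insert i s hi ih => rw [Finset.sum_insert hi]; exact (hμ i).add ih

/-- A level below the total mass of `B` is already exceeded by a finite partial sum. -/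
theorem sum {μ : ℕ → Measure α} (hμ : ∀ i, IsFiniteRadon (μ i))
    (hfin : IsFiniteMeasure (Measure.sum μ)) : IsFiniteRadon (Measure.sum μ) := by
  refine ⟨hfin, ⟨fun B hB r hr => ?_⟩⟩
  rw [Measure.sum_apply _ hB, ENNReal.tsum_eq_iSup_nat, lt_iSup_iff] at hr
  obtain ⟨n, hn⟩ := hr
  have := (finset_sum (Finset.range n) hμ).innerRegular
  obtain ⟨K, hKB, hK, h⟩ := hB.exists_lt_isCompact (μ := ∑ i ∈ Finset.range n, μ i) (r := r)
    (by simpa using hn)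
  refine ⟨K, hKB, hK, h.trans_le ?_⟩
  rw [Measure.finsetSum_apply]
  exact (ENNReal.sum_le_tsum _).trans (Measure.le_sum_apply _ _)

variable [T2Space α] [OpensMeasurableSpace α]

/-- A measurable set is exhausted by countably many compact sets up to a null set. -/
theorem exists_isCompact_diff_null {μ : Measure α} (hμ : IsFiniteRadon μ) {B : Set α}
    (hB : MeasurableSet B) :
    ∃ K : ℕ → Set α, (∀ n, IsCompact (K n)) ∧ (∀ n, K n ⊆ B) ∧ μ (B \ ⋃ n, K n) = 0 := by
  have := hμ.finite
  have := hμ.innerRegular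
  have key : ∀ n : ℕ, ∃ K ⊆ B, IsCompact K ∧ μ (B \ K) < ((n : ℝ≥0∞) + 1)⁻¹ := fun n =>
    hB.exists_isCompact_sdiff_lt (measure_ne_top _ _)
      (ENNReal.inv_ne_zero.2 (by finiteness))
  choose K hKB hK h using key
  refine ⟨K, hK, hKB, le_antisymm ?_ zero_le⟩
  refine ge_of_tendsto' (f := fun n : ℕ => ((n : ℝ≥0∞) + 1)⁻¹) (x := Filter.atTop) ?_ fun n =>
    (measure_mono (sdiff_subset_sdiff_right (subset_iUnion K n))).trans (h n).le
  simpa using (Filter.tendsto_add_atTop_iff_nat 1).2 ENNReal.tendsto_inv_nat_nhds_zero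

/-- Compact sets exhausting `B` up to a `μ`-null set also do so up to a `ν`-null set; continuity
from below along their finite unions concludes. -/
theorem of_absolutelyContinuous {μ ν : Measure α} (hμ : IsFiniteRadon μ)
    (hν : IsFiniteMeasure ν) (h : ν ≪ μ) : IsFiniteRadon ν := by
  refine ⟨hν, ⟨fun B hB r hr => ?_⟩⟩
  obtain ⟨K, hK, hKB, h0⟩ := hμ.exists_isCompact_diff_null hB
  have h1 : ν B ≤ ν (⋃ n, K n) := by
    refine (measure_mono (t := (⋃ n, K n) ∪ (B \ ⋃ n, K n)) (by simp)).trans ?_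
    exact (measure_union_le _ _).trans (by rw [h h0, add_zero])
  rw [measure_iUnion_eq_iSup_accumulate] at h1
  obtain ⟨n, hn⟩ := lt_iSup_iff.1 (hr.trans_le h1)
  refine ⟨accumulate K n, ?_, isCompact_accumulate hK n, hn⟩
  exact iUnion₂_subset fun i _ => hKB i

end IsFiniteRadon

/-- Meant for maps such as `Cone.pos`, which are continuous only after separating the vertex from
the rest. -/
theorem measurable_of_continuousOn_cover {α β ι : Type*} [TopologicalSpace α] [MeasurableSpace α]
    [OpensMeasurableSpace α] [TopologicalSpace β] [MeasurableSpace β] [BorelSpace β]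
    [Countable ι] {F : α → β} {A : ι → Set α} (hA : ∀ i, MeasurableSet (A i))
    (hcov : ∀ x, ∃ i, x ∈ A i) (hF : ∀ i, ContinuousOn F (A i)) : Measurable F := by
  refine measurable_of_isOpen fun U hU => ?_
  have : F ⁻¹' U = ⋃ i, F ⁻¹' U ∩ A i := by
    ext x
    obtain ⟨i, hi⟩ := hcov x
    simp only [mem_iUnion, mem_inter_iff]
    exact ⟨fun h => ⟨i, h, hi⟩, fun ⟨_, h, _⟩ => h⟩
  rw [this]
  refine MeasurableSet.iUnion fun i => ?_
  obtain ⟨V, hV, h⟩ := continuousOn_iff'.1 (hF i) U hU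
  rw [h]
  exact hV.measurableSet.inter (hA i)

/-- The push-forward of a Radon measure under a countably piecewise continuous map is Radon. -/
theorem IsFiniteRadon.map_of_continuousOn_cover {α β ι : Type*} [TopologicalSpace α]
    [MeasurableSpace α] [T2Space α] [OpensMeasurableSpace α] [TopologicalSpace β]
    [MeasurableSpace β] [BorelSpace β] [Countable ι] {F : α → β} {A : ι → Set α} {μ : Measure α}
    (hμ : IsFiniteRadon μ) (hA : ∀ i, MeasurableSet (A i))
    (hcov : ∀ x, ∃ i, x ∈ A i) (hF : ∀ i, ContinuousOn F (A i)) : IsFiniteRadon (μ.map F) := by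
  have := hμ.finite
  have := hμ.innerRegular
  have hFm := measurable_of_continuousOn_cover hA hcov hF
  rcases isEmpty_or_nonempty ι with hι | hι
  · have : IsEmpty α := ⟨fun x => (hcov x).elim fun i _ => hι.elim i⟩
    rw [Measure.eq_zero_of_isEmpty μ, Measure.map_zero]
    exact IsFiniteRadon.zero
  obtain ⟨e, he⟩ := exists_surjective_nat ι
  set D : ℕ → Set α := disjointed (A ∘ e) with hD
  have hDm : ∀ n, MeasurableSet (D n) := MeasurableSet.disjointed fun n => hA _
  have hDu : ⋃ n, D n = univ := by
    rw [hD, iUnion_disjointed, eq_univ_iff_forall]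
    intro x
    obtain ⟨i, hi⟩ := hcov x
    obtain ⟨n, rfl⟩ := he i
    exact mem_iUnion.2 ⟨n, hi⟩
  -- Disjoint pieces split the push-forward into a series; on each piece, compact sets have compact
  -- images.
  have hsum : μ.map F = Measure.sum fun n => (μ.restrict (D n)).map F := by
    rw [← Measure.map_sum hFm.aemeasurable, ← Measure.restrict_iUnion (disjoint_disjointed _) hDm,
      hDu, Measure.restrict_univ]
  have hfin : IsFiniteMeasure (μ.map F) := inferInstance
  rw [hsum] at hfin ⊢
  refine IsFiniteRadon.sum (fun n => ⟨inferInstance, ⟨fun B hB r hr => ?_⟩⟩) hfin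
  rw [Measure.map_apply hFm hB, Measure.restrict_apply (hFm hB)] at hr
  obtain ⟨K, hKB, hK, h⟩ := ((hFm hB).inter (hDm n)).exists_lt_isCompact hr
  refine ⟨F '' K, ?_, hK.image_of_continuousOn ((hF (e n)).mono ?_), ?_⟩
  · rintro _ ⟨x, hx, rfl⟩
    exact (hKB hx).1
  · exact fun x hx => disjointed_subset (A ∘ e) n (hKB hx).2
  · refine h.trans_le ?_
    calc μ K = μ.restrict (D n) K :=
          (Measure.restrict_eq_self _ fun x hx => (hKB hx).2).symm
      _ ≤ μ.restrict (D n) (F ⁻¹' (F '' K)) := measure_mono (subset_preimage_image _ _)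
      _ ≤ _ := Measure.le_map_apply hFm.aemeasurable _

theorem IsFiniteRadon.map_of_continuous {α β : Type*} [TopologicalSpace α]
    [MeasurableSpace α] [T2Space α] [OpensMeasurableSpace α] [TopologicalSpace β]
    [MeasurableSpace β] [BorelSpace β] {F : α → β} {μ : Measure α}
    (hμ : IsFiniteRadon μ) (hF : Continuous F) : IsFiniteRadon (μ.map F) :=
  hμ.map_of_continuousOn_cover (ι := Unit) (A := fun _ => univ) (fun _ => MeasurableSet.univ)
    (fun _ => ⟨(), mem_univ _⟩) fun _ => hF.continuousOn

/-! ### Products and cones -/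

namespace BorelProd

variable {α β γ : Type*} [TopologicalSpace α] [TopologicalSpace β] [TopologicalSpace γ]

theorem continuous_fst : Continuous (BorelProd.fst : BorelProd α β → α) := _root_.continuous_fst

theorem continuous_snd : Continuous (BorelProd.snd : BorelProd α β → β) := _root_.continuous_snd

theorem continuous_mk {f : γ → α} {g : γ → β} (hf : Continuous f) (hg : Continuous g) :
    Continuous fun x => BorelProd.mk (f x) (g x) := hf.prodMk hg

theorem continuousOn_mk {f : γ → α} {g : γ → β} {s : Set γ} (hf : ContinuousOn f s)
    (hg : ContinuousOn g s) : ContinuousOn (fun x => BorelProd.mk (f x) (g x)) s := hf.prodMk hg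

instance [T2Space α] [T2Space β] : T2Space (BorelProd α β) := inferInstanceAs (T2Space (α × β))

@[simp] theorem fst_mk {α β : Type*} (a : α) (b : β) : (BorelProd.mk a b).fst = a := rfl

@[simp] theorem snd_mk {α β : Type*} (a : α) (b : β) : (BorelProd.mk a b).snd = b := rfl

end BorelProd

namespace Cone

variable {X : Type*}

@[simp] theorem radius_mk (x : X) (r : ℝ≥0) : (mk x r).radius = r := rfl

theorem pos_mk (xbar x : X) (r : ℝ≥0) : (mk x r).pos xbar = if 0 < r then x else xbar := rfl

theorem exists_eq_mk (z : Cone X) : ∃ x r, z = mk x r := by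
  obtain ⟨⟨x, r⟩, rfl⟩ := Quotient.exists_rep z
  exact ⟨x, r, rfl⟩

theorem mk_zero (x y : X) : mk x 0 = mk y 0 := Quotient.sound (Or.inr ⟨rfl, rfl⟩)

variable [TopologicalSpace X]

theorem isOpen_iff {U : Set (Cone X)} : IsOpen U ↔ IsOpen {p : X × ℝ≥0 | mk p.1 p.2 ∈ U} ∧
    ((∃ x, mk x 0 ∈ U) → ∃ R : ℝ≥0, 0 < R ∧ ∀ y : Cone X, radius y ≤ R → y ∈ U) := Iff.rfl

theorem continuous_mk : Continuous fun p : X × ℝ≥0 => mk p.1 p.2 :=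
  continuous_def.2 fun _ hU => hU.1

theorem continuous_radius : Continuous (radius : Cone X → ℝ≥0) := by
  refine continuous_def.2 fun U hU => isOpen_iff.2 ⟨hU.preimage continuous_snd, ?_⟩
  rintro ⟨x, hx⟩
  have hx : (0 : ℝ≥0) ∈ U := hx
  obtain ⟨ε, hε, h⟩ := Metric.isOpen_iff.1 hU 0 hx
  -- Half of `ε`, because neighbourhoods of the vertex are given by `≤` and metric balls by `<`.
  refine ⟨Real.toNNReal (ε / 2), by simpa using hε, fun y hy => h ?_⟩
  have : (y.radius : ℝ) ≤ ε / 2 := by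
    simpa [Real.coe_toNNReal _ (by positivity : (0 : ℝ) ≤ ε / 2)] using NNReal.coe_le_coe.2 hy
  rw [Metric.mem_ball, NNReal.dist_eq]
  simp only [NNReal.coe_zero, sub_zero, NNReal.abs_eq]
  linarith

/-- Positions can be localized away from the vertex only; the vertex condition is then vacuous. -/
theorem isOpen_pos_preimage (xbar : X) {U : Set X} (hU : IsOpen U) :
    IsOpen {z : Cone X | 0 < z.radius ∧ z.pos xbar ∈ U} := by
  refine isOpen_iff.2 ⟨?_, ?_⟩
  · have : {p : X × ℝ≥0 | mk p.1 p.2 ∈ {z : Cone X | 0 < z.radius ∧ z.pos xbar ∈ U}} =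
        {p | 0 < p.2} ∩ Prod.fst ⁻¹' U := by
      ext p
      simp only [mem_ofPred_eq, radius_mk, pos_mk, mem_inter_iff, mem_preimage]
      exact and_congr_right fun h => by rw [if_pos h]
    rw [this]
    exact (isOpen_lt continuous_const continuous_snd).inter (hU.preimage continuous_fst)
  · rintro ⟨x, hx, _⟩
    simp at hx

theorem continuousOn_pos (xbar : X) : ContinuousOn (pos xbar) {z : Cone X | 0 < z.radius} := by
  refine continuousOn_iff'.2 fun U hU => ⟨_, isOpen_pos_preimage xbar hU, ?_⟩
  ext z
  simp only [mem_inter_iff, mem_preimage, mem_ofPred_eq]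
  tauto

/-- Points with different radii are separated by the radius; distinct points with equal radii have
positive radius and are separated by their positions. -/
instance [T2Space X] : T2Space (Cone X) where
  t2 := by
    intro z w hzw
    by_cases hr : z.radius = w.radius
    · obtain ⟨x, r, rfl⟩ := z.exists_eq_mk
      obtain ⟨y, s, rfl⟩ := w.exists_eq_mk
      obtain rfl : r = s := hr
      have hr0 : 0 < r := by
        rw [pos_iff_ne_zero]
        rintro rfl
        exact hzw (mk_zero x y)
      obtain ⟨U, V, hU, hV, hxU, hyV, hUV⟩ :=
        t2_separation (show x ≠ y from fun h => hzw (by rw [h]))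
      refine ⟨_, _, isOpen_pos_preimage x hU, isOpen_pos_preimage x hV, ⟨hr0, ?_⟩, ⟨hr0, ?_⟩, ?_⟩
      · rwa [pos_mk, if_pos hr0]
      · rwa [pos_mk, if_pos hr0]
      · exact Set.disjoint_left.2 fun a ha hb => Set.disjoint_left.1 hUV ha.2 hb.2
    · obtain ⟨U, V, hU, hV, hxU, hyV, hUV⟩ := t2_separation hr
      exact ⟨_, _, hU.preimage continuous_radius, hV.preimage continuous_radius, hxU, hyV,
        hUV.preimage _⟩

end Cone

/-! ### The cone cost of the marginal problem -/

section Cost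

variable {X : Type*} [MetricSpace X]

/-- The cone cost of the marginal Hellinger-Wasserstein problem. -/
def wheCost (xbar : X) (z : PCone X) : ℝ≥0∞ :=
  ENNReal.ofReal (((z.fst.radius : ℝ) - z.snd.radius) ^ 2) +
    if 0 < z.fst.radius then
      (z.snd.radius : ℝ≥0∞) ^ 2 * edist (z.fst.pos xbar) (z.snd.pos xbar) ^ 2 else 0

theorem isWHeCost_wheCost (xbar : X) : IsWHeCost (wheCost xbar) := by
  intro x₀ x₁ r₀ r₁
  by_cases h₀ : 0 < r₀
  · by_cases h₁ : 0 < r₁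
    · simp only [wheCost, BorelProd.fst_mk, BorelProd.snd_mk, Cone.radius_mk, Cone.pos_mk, h₀, h₁,
        if_true]
      rw [ENNReal.ofReal_add (by positivity) (by positivity), edist_dist,
        ENNReal.ofReal_mul (by positivity), ENNReal.ofReal_pow dist_nonneg,
        ENNReal.ofReal_pow NNReal.zero_le_coe, ENNReal.ofReal_coe_nnreal]
    · obtain rfl : r₁ = 0 := by simpa using h₁
      simp [wheCost]
      rw [if_pos h₀, ENNReal.ofReal_pow NNReal.zero_le_coe, ENNReal.ofReal_coe_nnreal]
  · obtain rfl : r₀ = 0 := by simpa using h₀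
    simp [wheCost]

theorem IsWHeCost.eq_wheCost (xbar : X) {H : PCone X → ℝ≥0∞} (hH : IsWHeCost H) :
    H = wheCost xbar := by
  funext z
  obtain ⟨z₀, z₁⟩ := z
  obtain ⟨x₀, r₀, rfl⟩ := z₀.exists_eq_mk
  obtain ⟨x₁, r₁, rfl⟩ := z₁.exists_eq_mk
  exact (hH x₀ x₁ r₀ r₁).trans (isWHeCost_wheCost xbar x₀ x₁ r₀ r₁).symm

theorem wheCost_lt_top (xbar : X) (z : PCone X) : wheCost xbar z < ⊤ := by
  unfold wheCost
  refine ENNReal.add_lt_top.2 ⟨ENNReal.ofReal_lt_top, ?_⟩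
  split_ifs
  · exact ENNReal.mul_lt_top (by finiteness) (ENNReal.pow_lt_top (edist_lt_top _ _))
  · simp

theorem IsWHeCost.isRadiallyTwoHomogeneous {H : PCone X → ℝ≥0∞} (hH : IsWHeCost H) :
    IsRadiallyTwoHomogeneous H := by
  intro x₀ x₁ r₀ r₁ t ht
  rw [hH, hH, ← ENNReal.ofReal_coe_nnreal, ← ENNReal.ofReal_pow NNReal.zero_le_coe,
    ← ENNReal.ofReal_mul (by positivity)]
  congr 1
  by_cases h : 0 < r₀
  · rw [if_pos h, if_pos (by positivity)]
    push_cast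
    ring
  · obtain rfl : r₀ = 0 := by simpa using h
    simp only [mul_zero, lt_self_iff_false, if_false]
    push_cast
    ring

theorem continuous_radius_fst : Continuous fun z : PCone X => z.fst.radius :=
  Cone.continuous_radius.comp BorelProd.continuous_fst

theorem continuous_radius_snd : Continuous fun z : PCone X => z.snd.radius :=
  Cone.continuous_radius.comp BorelProd.continuous_snd

theorem continuousOn_pos_fst (xbar : X) :
    ContinuousOn (fun z : PCone X => z.fst.pos xbar) {z | 0 < z.fst.radius} :=
  (Cone.continuousOn_pos xbar).comp BorelProd.continuous_fst.continuousOn fun _ h => h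

theorem continuousOn_pos_snd (xbar : X) :
    ContinuousOn (fun z : PCone X => z.snd.pos xbar) {z | 0 < z.snd.radius} :=
  (Cone.continuousOn_pos xbar).comp BorelProd.continuous_snd.continuousOn fun _ h => h

/-- The transport term is continuous where both radii are positive. Elsewhere it equals `0`, its
least possible value, so it may jump up nearby without harm. -/
theorem lowerSemicontinuous_wheCost (xbar : X) : LowerSemicontinuous (wheCost xbar) := by
  have h1 : Continuous fun z : PCone X =>
      ENNReal.ofReal (((z.fst.radius : ℝ) - z.snd.radius) ^ 2) := by
    have := continuous_radius_fst (X := X)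
    have := continuous_radius_snd (X := X)
    exact ENNReal.continuous_ofReal.comp (by fun_prop)
  refine h1.lowerSemicontinuous.add' (fun z => ?_) fun z => continuous_add.continuousAt
  by_cases hz : 0 < z.fst.radius ∧ 0 < z.snd.radius
  · refine ContinuousAt.lowerSemicontinuousAt ?_
    have ho : {z : PCone X | 0 < z.fst.radius ∧ 0 < z.snd.radius} ∈ 𝓝 z :=
      ((isOpen_lt continuous_const continuous_radius_fst).inter
        (isOpen_lt continuous_const continuous_radius_snd)).mem_nhds hz
    have h2 : ContinuousAt (fun z : PCone X => (z.snd.radius : ℝ≥0∞) ^ 2 *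
        ((nndist (z.fst.pos xbar) (z.snd.pos xbar) ^ 2 : ℝ≥0) : ℝ≥0∞)) z := by
      have c1 := (continuousOn_pos_fst xbar).continuousAt
        (Filter.mem_of_superset ho fun z h => h.1)
      have c2 := (continuousOn_pos_snd xbar).continuousAt
        (Filter.mem_of_superset ho fun z h => h.2)
      have c3 : ContinuousAt (fun z : PCone X => z.snd.radius ^ 2 *
          (nndist (z.fst.pos xbar) (z.snd.pos xbar) ^ 2)) z :=
        (continuous_radius_snd.continuousAt.pow 2).mul ((c1.nndist c2).pow 2)
      have := ENNReal.continuous_coe.continuousAt.comp c3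
      simpa [Function.comp_def] using this
    refine h2.congr (Filter.mem_of_superset ho fun z h => ?_)
    simp only [mem_ofPred_eq, if_pos h.1, edist_nndist, ENNReal.coe_pow]
  · have : (if 0 < z.fst.radius then
        (z.snd.radius : ℝ≥0∞) ^ 2 * edist (z.fst.pos xbar) (z.snd.pos xbar) ^ 2 else 0) = 0 := by
      split_ifs with h
      · have : z.snd.radius = 0 := by simpa [h] using hz
        simp [this]
      · rfl
    intro y hy
    rw [this] at hy
    exact absurd hy not_lt_zero

end Cost

/-! ### The Hellinger distance -/

section Hellinger

variable {X : Type*} [MeasurableSpace X]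

/-- Two finite measures are given by the densities `t` and `1 - t` with respect to their sum. -/
theorem exists_density_add (μ ν : Measure X) [IsFiniteMeasure μ] [IsFiniteMeasure ν] :
    ∃ t : X → unitInterval, Measurable t ∧
      μ = (μ + ν).withDensity (fun x => ENNReal.ofReal (t x)) ∧
      ν = (μ + ν).withDensity (fun x => ENNReal.ofReal (1 - t x)) ∧
      hellinger μ ν ^ 2 =
        ∫⁻ x, ENNReal.ofReal ((√(t x : ℝ) - √(1 - t x : ℝ)) ^ 2) ∂(μ + ν) := by
  set η := μ + ν with hη
  have hμη : μ ≪ η := Measure.absolutelyContinuous_of_le (Measure.le_add_right le_rfl)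
  have hνη : ν ≪ η := Measure.absolutelyContinuous_of_le (Measure.le_add_left le_rfl)
  set f := μ.rnDeriv η with hf
  set g := ν.rnDeriv η with hg
  have hsum : ∀ᵐ x ∂η, f x + g x = 1 := by
    filter_upwards [Measure.rnDeriv_add μ ν η, Measure.rnDeriv_self η] with x h1 h2
    rw [← hη, h2] at h1
    exact h1.symm
  -- The derivative lies in `[0, 1]` only almost everywhere; the projection makes the bounds hold
  -- everywhere.
  refine ⟨fun x => projIcc 0 1 zero_le_one (f x).toReal, ?_, ?_, ?_, ?_⟩
  · exact continuous_projIcc.measurable.comp (Measure.measurable_rnDeriv _ _).ennreal_toReal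
  all_goals
    have key : ∀ᵐ x ∂η, (projIcc 0 1 zero_le_one (f x).toReal : ℝ) = (f x).toReal ∧
        1 - (f x).toReal = (g x).toReal ∧ f x ≠ ⊤ ∧ g x ≠ ⊤ := by
      filter_upwards [hsum] with x hx
      have h1 : f x ≤ 1 := hx ▸ le_self_add
      have h2 : g x ≤ 1 := hx ▸ le_add_self
      have h3 : f x ≠ ⊤ := ne_top_of_le_ne_top ENNReal.one_ne_top h1
      have h4 : g x ≠ ⊤ := ne_top_of_le_ne_top ENNReal.one_ne_top h2
      refine ⟨?_, ?_, h3, h4⟩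
      · rw [projIcc_of_mem zero_le_one (x := (f x).toReal)
          ⟨ENNReal.toReal_nonneg, ENNReal.toReal_mono ENNReal.one_ne_top h1⟩]
      · have := congrArg ENNReal.toReal hx
        rw [ENNReal.toReal_add h3 h4, ENNReal.toReal_one] at this
        linarith
  · conv_lhs => rw [← Measure.withDensity_rnDeriv_eq μ η hμη]
    refine withDensity_congr_ae ?_
    filter_upwards [key] with x hx
    rw [hx.1, ENNReal.ofReal_toReal hx.2.2.1]
  · conv_lhs => rw [← Measure.withDensity_rnDeriv_eq ν η hνη]
    refine withDensity_congr_ae ?_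
    filter_upwards [key] with x hx
    rw [hx.1, hx.2.1, ENNReal.ofReal_toReal hx.2.2.2]
  · rw [hellinger, ← ENNReal.rpow_natCast, ← ENNReal.rpow_mul,
      show (1 / 2 : ℝ) * ((2 : ℕ) : ℝ) = 1 by norm_num, ENNReal.rpow_one]
    refine lintegral_congr_ae ?_
    filter_upwards [key] with x hx
    rw [hx.1, hx.2.1]

/-- Integrated against `η`, this says that squared Hellinger distance plus twice the affinity `∫
√(t(1 - t)) dη` is the total mass. -/
theorem sqrt_sub_sqrt_sq_add (t : unitInterval) :
    (√(t : ℝ) - √(1 - t : ℝ)) ^ 2 + 2 * (√(t : ℝ) * √(1 - t : ℝ)) = 1 := by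
  have h1 := Real.sq_sqrt t.2.1
  have h2 := Real.sq_sqrt (sub_nonneg.2 t.2.2)
  nlinarith

theorem ofReal_add_ofReal_one_sub (t : unitInterval) :
    ENNReal.ofReal t + ENNReal.ofReal (1 - t : ℝ) = 1 := by
  rw [← ENNReal.ofReal_add t.2.1 (sub_nonneg.2 t.2.2)]
  simp

theorem hellinger_sq_le (μ ν : Measure X) [IsFiniteMeasure μ] [IsFiniteMeasure ν] :
    hellinger μ ν ^ 2 ≤ μ univ + ν univ := by
  obtain ⟨t, -, -, -, h⟩ := exists_density_add μ ν
  rw [h, ← Measure.add_apply, ← lintegral_one]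
  refine lintegral_mono fun x => ?_
  rw [← ENNReal.ofReal_one]
  refine ENNReal.ofReal_le_ofReal ?_
  have := sqrt_sub_sqrt_sq_add (t x)
  have : 0 ≤ √(t x : ℝ) * √(1 - t x : ℝ) := by positivity
  linarith

theorem hellinger_sq_comm (μ ν : Measure X) : hellinger μ ν ^ 2 = hellinger ν μ ^ 2 := by
  unfold hellinger
  simp only [add_comm ν μ]
  congr 3
  ext x
  congr 1
  ring

theorem hellinger_sq_zero_left (ν : Measure X) [IsFiniteMeasure ν] :
    hellinger 0 ν ^ 2 = ν univ := by
  obtain ⟨t, ht, h0, -, h⟩ := exists_density_add 0 ν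
  rw [h, ← lintegral_one, zero_add]
  rw [zero_add] at h0
  refine lintegral_congr_ae ?_
  have : ∀ᵐ x ∂ν, ENNReal.ofReal (t x) = 0 :=
    (withDensity_eq_zero_iff (by fun_prop)).1 h0.symm
  filter_upwards [this] with x hx
  have : (t x : ℝ) = 0 := le_antisymm (ENNReal.ofReal_eq_zero.1 hx) (t x).2.1
  simp [this]

/-- The Hellinger distance decreases under push-forward. -/
theorem hellinger_sq_map_le {Z : Type*} [MeasurableSpace Z] (α : Measure Z) {y : Z → X}
    (hy : Measurable y) {a b : Z → ℝ≥0} (ha : Measurable a) (hb : Measurable b)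
    (hfa : ∫⁻ z, (a z : ℝ≥0∞) ^ 2 ∂α ≠ ⊤) (hfb : ∫⁻ z, (b z : ℝ≥0∞) ^ 2 ∂α ≠ ⊤) :
    hellinger ((α.withDensity fun z => (a z : ℝ≥0∞) ^ 2).map y)
      ((α.withDensity fun z => (b z : ℝ≥0∞) ^ 2).map y) ^ 2 ≤
      ∫⁻ z, ENNReal.ofReal (((a z : ℝ) - b z) ^ 2) ∂α := by
  have ham : Measurable fun z => (a z : ℝ≥0∞) ^ 2 := by fun_prop
  have hbm : Measurable fun z => (b z : ℝ≥0∞) ^ 2 := by fun_prop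
  have := isFiniteMeasure_withDensity hfa
  have := isFiniteMeasure_withDensity hfb
  set μ := (α.withDensity fun z => (a z : ℝ≥0∞) ^ 2).map y with hμ
  set ν := (α.withDensity fun z => (b z : ℝ≥0∞) ^ 2).map y with hν
  obtain ⟨t, ht, hμt, hνt, h⟩ := exists_density_add μ ν
  have hμm : μ univ = ∫⁻ z, (a z : ℝ≥0∞) ^ 2 ∂α := by
    rw [hμ, Measure.map_apply hy MeasurableSet.univ]; simp
  have hνm : ν univ = ∫⁻ z, (b z : ℝ≥0∞) ^ 2 ∂α := by
    rw [hν, Measure.map_apply hy MeasurableSet.univ]; simp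
  set η := μ + ν with hη
  -- `P` is the Hellinger affinity. Expanding both squares reduces the claim to `∫ a b dα ≤ P`.
  set P : ℝ≥0∞ := ∫⁻ x, ENNReal.ofReal (√(t x : ℝ) * √(1 - t x : ℝ)) ∂η with hP
  have hPtop : P ≠ ⊤ := by
    refine ne_top_of_le_ne_top (measure_ne_top η univ) ?_
    rw [hP, ← lintegral_one]
    refine lintegral_mono fun x => ?_
    rw [← ENNReal.ofReal_one]
    refine ENNReal.ofReal_le_ofReal ?_
    have := sqrt_sub_sqrt_sq_add (t x)
    nlinarith [sq_nonneg (√(t x : ℝ) - √(1 - t x : ℝ)), Real.sqrt_nonneg (t x : ℝ),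
      Real.sqrt_nonneg (1 - t x : ℝ), mul_nonneg (Real.sqrt_nonneg (t x : ℝ))
        (Real.sqrt_nonneg (1 - t x : ℝ))]
  have hid : hellinger μ ν ^ 2 + 2 * P = μ univ + ν univ := by
    rw [h, hP, ← lintegral_const_mul _ (by fun_prop), ← lintegral_add_left (by fun_prop),
      ← Measure.add_apply, ← lintegral_one]
    refine lintegral_congr fun x => ?_
    rw [← ENNReal.ofReal_ofNat 2, ← ENNReal.ofReal_mul (by norm_num),
      ← ENNReal.ofReal_add (by positivity) (by positivity), sqrt_sub_sqrt_sq_add,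
      ENNReal.ofReal_one]
  have hid' : μ univ + ν univ = ∫⁻ z, ENNReal.ofReal (((a z : ℝ) - b z) ^ 2) ∂α +
      ∫⁻ z, 2 * ((a z : ℝ≥0∞) * b z) ∂α := by
    rw [hμm, hνm, ← lintegral_add_left ham, ← lintegral_add_left (by fun_prop)]
    refine lintegral_congr fun z => ?_
    rw [← ENNReal.ofReal_coe_nnreal, ← ENNReal.ofReal_coe_nnreal, ← ENNReal.ofReal_ofNat 2,
      ← ENNReal.ofReal_mul (by positivity), ← ENNReal.ofReal_mul (by positivity),
      ← ENNReal.ofReal_pow (by positivity), ← ENNReal.ofReal_pow (by positivity),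
      ← ENNReal.ofReal_add (by positivity) (by positivity),
      ← ENNReal.ofReal_add (by positivity) (by positivity)]
    congr 1
    ring
  -- These two facts make the quotients below genuine wherever `a` and `b` are both nonzero, instead
  -- of the default value of division by zero.
  have hta : ∀ᵐ z ∂α, a z ≠ 0 → 0 < (t (y z) : ℝ) := by
    have h1 : ∀ᵐ x ∂μ, 0 < (t x : ℝ) := by
      rw [hμt, ae_withDensity_iff (by fun_prop)]
      exact Filter.Eventually.of_forall fun x hx => ENNReal.ofReal_pos.1 (pos_iff_ne_zero.2 hx)
    have h2 := ae_of_ae_map hy.aemeasurable h1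
    rw [ae_withDensity_iff ham] at h2
    filter_upwards [h2] with z hz h0
    exact hz (by simpa using h0)
  have htb : ∀ᵐ z ∂α, b z ≠ 0 → 0 < (1 - t (y z) : ℝ) := by
    have h1 : ∀ᵐ x ∂ν, 0 < (1 - t x : ℝ) := by
      rw [hνt, ae_withDensity_iff (by fun_prop)]
      exact Filter.Eventually.of_forall fun x hx => ENNReal.ofReal_pos.1 (pos_iff_ne_zero.2 hx)
    have h2 := ae_of_ae_map hy.aemeasurable h1
    rw [ae_withDensity_iff hbm] at h2
    filter_upwards [h2] with z hz h0
    exact hz (by simpa using h0)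
  -- Pushing `a²` forward by `y` gives density `t`, and `t · √(1 - t) / √t = √t · √(1 - t)`, also at
  -- `t = 0`.
  have hc : ∫⁻ z, (a z : ℝ≥0∞) ^ 2 * ENNReal.ofReal (√(1 - t (y z) : ℝ) / √(t (y z) : ℝ)) ∂α
      = P := by
    have e : ∫⁻ x, ENNReal.ofReal (√(1 - t x : ℝ) / √(t x : ℝ)) ∂μ = P := by
      rw [hμt, lintegral_withDensity_eq_lintegral_mul _ (by fun_prop) (by fun_prop)]
      refine lintegral_congr fun x => ?_
      rw [Pi.mul_apply, ← ENNReal.ofReal_mul (t x).2.1]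
      congr 1
      rw [mul_div_left_comm, Real.div_sqrt, mul_comm]
    rw [← e, hμ, lintegral_map (by fun_prop) hy,
      lintegral_withDensity_eq_lintegral_mul _ ham (by fun_prop)]
    rfl
  have hd : ∫⁻ z, (b z : ℝ≥0∞) ^ 2 * ENNReal.ofReal (√(t (y z) : ℝ) / √(1 - t (y z) : ℝ)) ∂α
      = P := by
    have e : ∫⁻ x, ENNReal.ofReal (√(t x : ℝ) / √(1 - t x : ℝ)) ∂ν = P := by
      rw [hνt, lintegral_withDensity_eq_lintegral_mul _ (by fun_prop) (by fun_prop)]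
      refine lintegral_congr fun x => ?_
      have h1 := sub_nonneg.2 (t x).2.2
      rw [Pi.mul_apply, ← ENNReal.ofReal_mul h1]
      congr 1
      rw [mul_div_left_comm, Real.div_sqrt]
    rw [← e, hν, lintegral_map (by fun_prop) hy,
      lintegral_withDensity_eq_lintegral_mul _ hbm (by fun_prop)]
    rfl
  -- Weighted AM-GM: `2ab ≤ a² √(1 - t) / √t + b² √t / √(1 - t)`, where each term on the right
  -- integrates to `P`.
  have hle : ∫⁻ z, 2 * ((a z : ℝ≥0∞) * b z) ∂α ≤ 2 * P := by
    rw [two_mul P]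
    nth_rw 1 [← hc]
    rw [← hd, ← lintegral_add_left (by fun_prop)]
    refine lintegral_mono_ae ?_
    filter_upwards [hta, htb] with z h1 h2
    rcases eq_or_ne (a z) 0 with h3 | h3
    · simp [h3]
    rcases eq_or_ne (b z) 0 with h4 | h4
    · simp [h4]
    have p := Real.sqrt_pos.2 (h1 h3)
    have q := Real.sqrt_pos.2 (h2 h4)
    rw [← ENNReal.ofReal_coe_nnreal, ← ENNReal.ofReal_coe_nnreal, ← ENNReal.ofReal_ofNat 2,
      ← ENNReal.ofReal_mul (by positivity), ← ENNReal.ofReal_mul (by positivity),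
      ← ENNReal.ofReal_pow (by positivity), ← ENNReal.ofReal_pow (by positivity),
      ← ENNReal.ofReal_mul (by positivity), ← ENNReal.ofReal_mul (by positivity),
      ← ENNReal.ofReal_add (by positivity) (by positivity)]
    refine ENNReal.ofReal_le_ofReal ?_
    rw [← sub_nonneg]
    have : (a z : ℝ) ^ 2 * (√(1 - t (y z) : ℝ) / √(t (y z) : ℝ)) +
        (b z : ℝ) ^ 2 * (√(t (y z) : ℝ) / √(1 - t (y z) : ℝ)) - 2 * ((a z : ℝ) * b z) =
        ((a z : ℝ) * √(1 - t (y z) : ℝ) - b z * √(t (y z) : ℝ)) ^ 2 /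
          (√(t (y z) : ℝ) * √(1 - t (y z) : ℝ)) := by
      field_simp
      ring
    rw [this]
    positivity
  have h2P : 2 * P ≠ ⊤ := ENNReal.mul_ne_top (by norm_num) hPtop
  refine (ENNReal.add_le_add_iff_right h2P).1 ?_
  rw [hid, hid']
  gcongr

end Hellinger

/-! ### From homogeneous couplings to intermediate measures -/

section Glue

variable {X : Type*} [MetricSpace X] [MeasurableSpace X]

theorem wasserstein_sq (μ ν : Measure X) :
    wasserstein μ ν ^ 2 = ⨅ γ ∈ Couplings μ ν, ∫⁻ z, edist z.fst z.snd ^ 2 ∂γ := by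
  rw [wasserstein, ← ENNReal.rpow_natCast, ← ENNReal.rpow_mul]
  norm_num

variable [BorelSpace X]

theorem Couplings.measure_univ_eq {μ ν : Measure X} {γ : Measure (BorelProd X X)}
    (hγ : γ ∈ Couplings μ ν) : μ univ = ν univ := by
  obtain ⟨-, rfl, rfl⟩ := hγ
  rw [Measure.map_apply BorelProd.continuous_fst.measurable MeasurableSet.univ,
    Measure.map_apply BorelProd.continuous_snd.measurable MeasurableSet.univ]
  simp

theorem wasserstein_sq_self {μ : Measure X} (hμ : IsFiniteRadon μ) :
    wasserstein μ μ ^ 2 = 0 := by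
  have hc : Continuous fun x : X => BorelProd.mk x x :=
    BorelProd.continuous_mk continuous_id continuous_id
  have hmem : (μ.map fun x => BorelProd.mk x x) ∈ Couplings μ μ := by
    refine ⟨hμ.map_of_continuous hc, ?_, ?_⟩
    · rw [Measure.map_map BorelProd.continuous_fst.measurable hc.measurable]
      exact Measure.map_id
    · rw [Measure.map_map BorelProd.continuous_snd.measurable hc.measurable]
      exact Measure.map_id
  rw [wasserstein_sq, ← nonpos_iff_eq_zero]
  refine (iInf₂_le _ hmem).trans ((lintegral_map_le _ _).trans ?_)
  simp

theorem Cone.pos_of_not {X : Type*} (xbar : X) {z : Cone X} (hz : ¬ 0 < z.radius) :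
    z.pos xbar = xbar := by
  obtain ⟨x, r, rfl⟩ := z.exists_eq_mk
  exact if_neg hz

theorem Cone.measurable_pos (xbar : X) : Measurable (Cone.pos xbar : Cone X → X) := by
  have ho : MeasurableSet {z : Cone X | 0 < z.radius} :=
    (isOpen_lt continuous_const Cone.continuous_radius).measurableSet
  refine measurable_of_continuousOn_cover (ι := Bool)
    (A := fun i => cond i {z : Cone X | 0 < z.radius} {z | ¬ 0 < z.radius}) ?_ ?_ ?_
  · rintro (_ | _)
    exacts [ho.compl, ho]
  · intro z
    by_cases h : 0 < z.radius
    · exact ⟨true, h⟩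
    · exact ⟨false, h⟩
  · rintro (_ | _)
    · exact continuousOn_const.congr (f := fun _ => xbar) fun z hz => Cone.pos_of_not _ hz
    · exact Cone.continuousOn_pos xbar

/-- Each homogeneous coupling induces an intermediate measure for the marginal problem, at no
greater cost. -/
theorem HomCouplings.exists_intermediate {xbar : X} {μ₀ μ₁ : Measure X} {α : Measure (PCone X)}
    (hα : α ∈ HomCouplings xbar μ₀ μ₁) :
    ∃ ν : Measure X, IsFiniteRadon ν ∧
      hellinger μ₀ ν ^ 2 + wasserstein ν μ₁ ^ 2 ≤ ∫⁻ z, wheCost xbar z ∂α := by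
  obtain ⟨hR, hfin, h0, h1⟩ := hα
  have m0 : Measurable fun z : PCone X => z.fst.radius := continuous_radius_fst.measurable
  have m1 : Measurable fun z : PCone X => z.snd.radius := continuous_radius_snd.measurable
  have f0 : ∫⁻ z, (z.fst.radius : ℝ≥0∞) ^ 2 ∂α ≠ ⊤ :=
    ((lintegral_mono fun z => le_self_add).trans_lt hfin).ne
  have f1 : ∫⁻ z, (z.snd.radius : ℝ≥0∞) ^ 2 ∂α ≠ ⊤ :=
    ((lintegral_mono fun z => le_add_self).trans_lt hfin).ne
  set β := α.withDensity fun z => (z.snd.radius : ℝ≥0∞) ^ 2 with hβ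
  have hβR : IsFiniteRadon β := hR.of_absolutelyContinuous (isFiniteMeasure_withDensity f1)
    (withDensity_absolutelyContinuous _ _)
  -- Where `r₀ = 0` the cone cost charges no distance, so the intermediate mass is created at its
  -- final place.
  set y : PCone X → X := fun z => if 0 < z.fst.radius then z.fst.pos xbar else z.snd.pos xbar
    with hy
  set P : PCone X → BorelProd X X := fun z => BorelProd.mk (y z) (z.snd.pos xbar) with hP
  -- `P` is continuous on each of the four pieces cut out by the vanishing of the radii.
  set A : Bool × Bool → Set (PCone X) := fun i =>
    (cond i.1 {z : PCone X | 0 < z.fst.radius} {z | ¬ 0 < z.fst.radius}) ∩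
      (cond i.2 {z : PCone X | 0 < z.snd.radius} {z | ¬ 0 < z.snd.radius}) with hA
  have hAm : ∀ i, MeasurableSet (A i) := by
    have o0 : MeasurableSet {z : PCone X | 0 < z.fst.radius} :=
      (isOpen_lt continuous_const continuous_radius_fst).measurableSet
    have o1 : MeasurableSet {z : PCone X | 0 < z.snd.radius} :=
      (isOpen_lt continuous_const continuous_radius_snd).measurableSet
    rintro ⟨_ | _, _ | _⟩
    exacts [o0.compl.inter o1.compl, o0.compl.inter o1, o0.inter o1.compl, o0.inter o1]
  have hAc : ∀ z, ∃ i, z ∈ A i := by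
    intro z
    by_cases h : 0 < z.fst.radius <;> by_cases k : 0 < z.snd.radius
    exacts [⟨(true, true), h, k⟩, ⟨(true, false), h, k⟩, ⟨(false, true), h, k⟩,
      ⟨(false, false), h, k⟩]
  have hPA : ∀ i, ContinuousOn P (A i) := by
    rintro ⟨i, j⟩
    have hsnd : ContinuousOn (fun z : PCone X => z.snd.pos xbar) (A (i, j)) := by
      rcases j with _ | _
      · exact continuousOn_const.congr (f := fun _ => xbar) fun z hz => Cone.pos_of_not _ hz.2
      · exact (continuousOn_pos_snd xbar).mono fun z hz => hz.2
    refine BorelProd.continuousOn_mk ?_ hsnd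
    rcases i with _ | _
    · exact hsnd.congr fun z hz => if_neg hz.1
    · exact ((continuousOn_pos_fst xbar).mono fun z hz => hz.1).congr fun z hz => if_pos hz.1
  have hPm : Measurable P := measurable_of_continuousOn_cover hAm hAc hPA
  have hym : Measurable y := BorelProd.continuous_fst.measurable.comp hPm
  have hγR : IsFiniteRadon (β.map P) := hβR.map_of_continuousOn_cover hAm hAc hPA
  have hν : (β.map P).map BorelProd.fst = β.map y :=
    Measure.map_map BorelProd.continuous_fst.measurable hPm
  have hνR : IsFiniteRadon (β.map y) := hν ▸ hγR.map_of_continuous BorelProd.continuous_fst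
  refine ⟨β.map y, hνR, ?_⟩
  -- `y` differs from the first position only where the density `r₀²` vanishes.
  have hμ₀ : μ₀ = (α.withDensity fun z => (z.fst.radius : ℝ≥0∞) ^ 2).map y := by
    rw [← h0, homMarginal₀]
    refine Measure.map_congr ?_
    refine (ae_withDensity_iff (by fun_prop)).2 (Filter.Eventually.of_forall fun z hz => ?_)
    have : 0 < z.fst.radius := by
      rw [pos_iff_ne_zero]
      intro h
      simp [h] at hz
    simp only [hy, if_pos this]
  have hcost : ∫⁻ z, wheCost xbar z ∂α =
      ∫⁻ z, ENNReal.ofReal (((z.fst.radius : ℝ) - z.snd.radius) ^ 2) ∂α +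
        ∫⁻ z, (z.snd.radius : ℝ≥0∞) ^ 2 * edist (P z).fst (P z).snd ^ 2 ∂α := by
    rw [← lintegral_add_left (by fun_prop)]
    refine lintegral_congr fun z => ?_
    simp only [wheCost, hP, BorelProd.fst_mk, BorelProd.snd_mk, hy]
    split_ifs <;> simp
  rw [hcost]
  refine add_le_add ?_ ?_
  · rw [hμ₀]
    exact hellinger_sq_map_le α hym m0 m1 f0 f1
  · have hmem : β.map P ∈ Couplings (β.map y) μ₁ := by
      refine ⟨hγR, hν, ?_⟩
      rw [Measure.map_map BorelProd.continuous_snd.measurable hPm, ← h1]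
      rfl
    have hd : Continuous fun z : BorelProd X X => edist z.fst z.snd ^ 2 :=
      (ENNReal.continuous_pow 2).comp
        (BorelProd.continuous_fst.edist BorelProd.continuous_snd)
    rw [wasserstein_sq]
    refine (iInf₂_le _ hmem).trans ?_
    rw [lintegral_map hd.measurable hPm, hβ]
    exact (lintegral_withDensity_eq_lintegral_mul α (m1.coe_nnreal_ennreal.pow_const 2)
      (hd.measurable.comp hPm)).le

end Glue

/-! ### A compact model of the pairs of points -/

/-- A compact metrizable space recording truncated distances from a sequence of points. -/
abbrev DistBox : Type := (i : ℕ) → Icc (0 : ℝ) (i : ℝ)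

/-- Pairs of points in the compact model, with the squared first radius under the normalization
`r₀ ^ 2 + r₁ ^ 2 = 1`. -/
abbrev DistPair : Type := DistBox × DistBox × unitInterval

section DistCoord

variable {X : Type*} [MetricSpace X]

/-- The truncated distances of a point from the points of a sequence. -/
def distCoord (z : ℕ → X) (x : X) : DistBox := fun i =>
  ⟨min (dist (z i) x) i, le_min dist_nonneg (Nat.cast_nonneg i), min_le_right _ _⟩

/-- Coordinates never overestimate distances, so costs computed in the compact model are lower
bounds. -/
theorem nndist_distCoord_le (z : ℕ → X) (x y : X) (i : ℕ) :
    nndist (distCoord z x i) (distCoord z y i) ≤ nndist x y := by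
  have h := ((LipschitzWith.dist_right (z i)).min_const (i : ℝ)).dist_le_mul x y
  rw [NNReal.coe_one, one_mul] at h
  exact_mod_cast h

theorem continuous_distCoord (z : ℕ → X) : Continuous (distCoord z) := by
  refine continuous_pi fun i => ?_
  exact Continuous.subtype_mk ((continuous_const.dist continuous_id).min continuous_const) _

/-- A countable family is enumerated with infinite repetition by means of `Nat.unpair`. Every good
centre thus recurs at large indices, where the truncation level `i` is large. -/
theorem exists_seq_frequently_dist_lt {Y : Set X} (hY : TopologicalSpace.IsSeparable Y)
    (hne : Y.Nonempty) :
    ∃ z : ℕ → X, ∀ x ∈ Y, ∀ N : ℕ, ∀ ε > 0, ∃ i ≥ N, dist (z i) x < ε := by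
  obtain ⟨c, hc, hYc⟩ := hY
  have hcne : c.Nonempty := by
    obtain ⟨y, hy⟩ := hne
    exact closure_nonempty_iff.1 ⟨y, hYc hy⟩
  obtain ⟨d, rfl⟩ := hc.exists_eq_range hcne
  refine ⟨fun i => d (Nat.unpair i).1, fun x hx N ε hε => ?_⟩
  obtain ⟨_, ⟨j, rfl⟩, hj⟩ := Metric.mem_closure_iff.1 (hYc hx) ε hε
  refine ⟨Nat.pair j N, Nat.right_le_pair j N, ?_⟩
  simpa [dist_comm] using hj

/-- Take a centre within `ε / 2` of `x` with truncation level at least `dist x y`: its coordinate is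
at most `ε / 2` at `x` and at least `dist x y - ε / 2` at `y`. Only `x` has to be approximated. -/
theorem edist_sq_le_iSup_distCoord {z : ℕ → X} {x : X}
    (hx : ∀ N : ℕ, ∀ ε > 0, ∃ i ≥ N, dist (z i) x < ε) (y : X) :
    edist x y ^ 2 ≤ ⨆ i, (nndist (distCoord z x i) (distCoord z y i) : ℝ≥0∞) ^ 2 := by
  rw [← ENNReal.iSup_pow]
  refine pow_le_pow_left' (ENNReal.le_of_forall_pos_le_add fun ε hε _ => ?_) 2
  have hε' : (0 : ℝ) < ε := hε
  obtain ⟨i, hi, h⟩ := hx ⌈dist x y⌉₊ (ε / 2) (by positivity)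
  have hi : dist x y ≤ i := Nat.ceil_le.1 hi
  have key : dist x y ≤ dist (distCoord z x i) (distCoord z y i) + ε := by
    have h1 : dist x y ≤ dist (z i) x + dist (z i) y := dist_triangle_left _ _ _
    have h2 : min (dist (z i) x) i ≤ ε / 2 := (min_le_left _ _).trans h.le
    have h3 : dist x y - ε / 2 ≤ min (dist (z i) y) i := le_min (by linarith) (by linarith)
    rw [dist_comm (distCoord z x i), Subtype.dist_eq, Real.dist_eq]
    have h4 := le_abs_self (((distCoord z y i : Icc (0 : ℝ) i) : ℝ) - (distCoord z x i))
    change min (dist (z i) y) i - min (dist (z i) x) i ≤ _ at h4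
    linarith
  have key' : nndist x y ≤ nndist (distCoord z x i) (distCoord z y i) + ε := by
    exact_mod_cast key
  rw [edist_nndist]
  refine (ENNReal.coe_le_coe.2 key').trans ?_
  rw [ENNReal.coe_add]
  gcongr
  exact le_iSup (fun i => (nndist (distCoord z x i) (distCoord z y i) : ℝ≥0∞)) i

theorem eq_of_distCoord_eq {z : ℕ → X} {x : X}
    (hx : ∀ N : ℕ, ∀ ε > 0, ∃ i ≥ N, dist (z i) x < ε) {y : X}
    (h : distCoord z x = distCoord z y) : x = y := by
  have := edist_sq_le_iSup_distCoord hx y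
  simpa [h] using this

end DistCoord

/-- A continuous map that is injective on a countable union of compact sets has a left inverse
on that union which is piecewise continuous for a countable measurable partition. -/
theorem exists_piecewise_continuous_leftInverse {X Q : Type*} [TopologicalSpace X]
    [TopologicalSpace Q] [T2Space X] [T2Space Q] [MeasurableSpace Q] [OpensMeasurableSpace Q]
    (xbar : X) {e : X → Q} (he : Continuous e) {K : ℕ → Set X} (hK : ∀ n, IsCompact (K n))
    (hinj : InjOn e (⋃ n, K n)) :
    ∃ (s : Q → X) (A : Option ℕ → Set Q), (∀ x ∈ ⋃ n, K n, s (e x) = x) ∧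
      (∀ i, MeasurableSet (A i)) ∧ (∀ q, ∃ i, q ∈ A i) ∧ ∀ i, ContinuousOn s (A i) := by
  classical
  set Y := ⋃ n, K n with hY
  set s : Q → X := fun q => if h : ∃ x ∈ Y, e x = q then h.choose else xbar with hs
  have hse : ∀ x ∈ Y, s (e x) = x := by
    intro x hx
    have h : ∃ x' ∈ Y, e x' = e x := ⟨x, hx, rfl⟩
    simp only [hs, dif_pos h]
    exact hinj h.choose_spec.1 hx h.choose_spec.2
  have hcl : ∀ n, IsClosed (e '' K n) := fun n => ((hK n).image he).isClosed
  refine ⟨s, fun i => i.elim (⋃ n, e '' K n)ᶜ fun n => e '' K n, hse, ?_, ?_, ?_⟩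
  · rintro (_ | n)
    · exact (MeasurableSet.iUnion fun n => (hcl n).measurableSet).compl
    · exact (hcl n).measurableSet
  · intro q
    by_cases h : q ∈ ⋃ n, e '' K n
    · obtain ⟨n, hn⟩ := mem_iUnion.1 h
      exact ⟨some n, hn⟩
    · exact ⟨none, h⟩
  · rintro (_ | n)
    · refine continuousOn_const.congr (f := fun _ => xbar) fun q hq => dif_neg ?_
      rintro ⟨x, hx, rfl⟩
      obtain ⟨n, hn⟩ := mem_iUnion.1 hx
      exact hq (mem_iUnion.2 ⟨n, x, hn, rfl⟩)
    -- On `e '' K n`, the preimage of a closed set `t` under `s` is `e '' (t ∩ K n)`, which is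
    -- compact and hence closed.
    · refine continuousOn_iff_isClosed.2 fun t ht =>
        ⟨e '' (t ∩ K n), (((hK n).inter_left ht).image he).isClosed, ?_⟩
      ext q
      constructor
      · rintro ⟨hq, x, hx, rfl⟩
        rw [mem_preimage, hse x (mem_iUnion.2 ⟨n, hx⟩)] at hq
        exact ⟨⟨x, ⟨hq, hx⟩, rfl⟩, x, hx, rfl⟩
      · rintro ⟨⟨x, ⟨hxt, hx⟩, rfl⟩, -⟩
        refine ⟨?_, x, hx, rfl⟩
        rwa [mem_preimage, hse x (mem_iUnion.2 ⟨n, hx⟩)]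

/-! ### Limits of measures on compact spaces -/

/-- On a compact space, a sequence of measures of bounded mass converges along an ultrafilter. -/
theorem exists_ultrafilter_limit {Ω : Type*} [TopologicalSpace Ω] [T2Space Ω] [CompactSpace Ω]
    [MeasurableSpace Ω] [BorelSpace Ω] (A : ℕ → Measure Ω) {M : ℝ≥0∞} (hM : M ≠ ⊤)
    (hA : ∀ n, A n univ ≤ M) :
    ∃ B : Measure Ω, IsFiniteMeasure B ∧ ∀ f : C(Ω, ℝ≥0),
      Filter.Tendsto (fun n => ∫⁻ q, f q ∂A n) (Filter.hyperfilter ℕ) (𝓝 (∫⁻ q, f q ∂B)) := by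
  have hfin : ∀ n, IsFiniteMeasure (A n) := fun n => ⟨(hA n).trans_lt hM.lt_top⟩
  set a : ℕ → FiniteMeasure Ω := fun n => ⟨A n, hfin n⟩ with ha
  have hcomp := isCompact_setOfPred_finiteMeasure_le_of_compactSpace Ω M.toNNReal
  obtain ⟨B, -, hB⟩ := hcomp.ultrafilter_le_nhds ((Filter.hyperfilter ℕ).map a) (by
    refine Filter.le_principal_iff.2 (Filter.mem_map.2 (Filter.univ_mem' fun n => ?_))
    exact ENNReal.toNNReal_mono hM (hA n))
  refine ⟨B, inferInstance, fun f => ?_⟩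
  exact FiniteMeasure.tendsto_iff_forall_lintegral_tendsto.1
    (show Filter.Tendsto a (Filter.hyperfilter ℕ) (𝓝 B) from hB)
    (BoundedContinuousFunction.mkOfCompact f)

/-! ### Lifting couplings to the compact model -/

section Lift

variable {X Q : Type*} [MetricSpace X] [MeasurableSpace X] [BorelSpace X] [MeasurableSpace Q]

/-- Each coupling of an intermediate measure with `μ₁` induces a measure on the compact model with
the homogeneous marginals of `μ₀` and `μ₁`. -/
theorem exists_lift {μ₀ μ₁ ν : Measure X} [IsFiniteMeasure μ₀] [IsFiniteMeasure ν]
    {γ : Measure (BorelProd X X)} (hγ : γ ∈ Couplings ν μ₁) {e : X → Q} (he : Measurable e) :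
    ∃ A : Measure (Q × Q × unitInterval),
      (∀ φ : Q → ℝ≥0∞, Measurable φ →
        ∫⁻ q, φ q.1 * ENNReal.ofReal (q.2.2 : ℝ) ∂A = ∫⁻ x, φ (e x) ∂μ₀) ∧
      (∀ φ : Q → ℝ≥0∞, Measurable φ →
        ∫⁻ q, φ q.2.1 * ENNReal.ofReal (1 - q.2.2 : ℝ) ∂A = ∫⁻ x, φ (e x) ∂μ₁) ∧
      ∀ κ : Q × Q × unitInterval → ℝ≥0∞, Measurable κ →
        (∀ x y t, κ (e x, e y, t) ≤ edist x y ^ 2) →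
        ∫⁻ q, ENNReal.ofReal ((√(q.2.2 : ℝ) - √(1 - q.2.2 : ℝ)) ^ 2) +
          ENNReal.ofReal (1 - q.2.2 : ℝ) * κ q ∂A ≤
          hellinger μ₀ ν ^ 2 + ∫⁻ p, edist p.fst p.snd ^ 2 ∂γ := by
  obtain ⟨-, hfst, hsnd⟩ := hγ
  obtain ⟨t, ht, h0, h1, hH⟩ := exists_density_add μ₀ ν
  set η := μ₀ + ν with hη
  have mf : Measurable (BorelProd.fst : BorelProd X X → X) := BorelProd.continuous_fst.measurable
  have ms : Measurable (BorelProd.snd : BorelProd X X → X) := BorelProd.continuous_snd.measurable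
  have mtf : Measurable fun p : BorelProd X X => t p.fst := ht.comp mf
  have mtr : Measurable fun x => ENNReal.ofReal (1 - t x : ℝ) := by fun_prop
  have mtfr : Measurable fun p : BorelProd X X => (ENNReal.ofReal (1 - t p.fst : ℝ))⁻¹ :=
    (mtr.comp mf).inv
  set G : BorelProd X X → Q × Q × unitInterval := fun p => (e p.fst, e p.snd, t p.fst) with hG
  have mG : Measurable G := (he.comp mf).prodMk ((he.comp ms).prodMk mtf)
  set G' : X → Q × Q × unitInterval := fun x => (e x, e x, 1) with hG'
  have mG' : Measurable G' := he.prodMk (he.prodMk measurable_const)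
  -- On `T` the density of `ν` vanishes, so `γ` does not see this part of `μ₀`. It is lifted with
  -- second radius `0`, and its second point, here `e x`, is immaterial.
  set T : Set X := {x | (t x : ℝ) = 1} with hT
  have mT : MeasurableSet T := measurableSet_eq_fun (by fun_prop) measurable_const
  -- Dividing by `1 - t` turns the first marginal `(1 - t)η` of `γ` into `η` off `T`. The value `∞`
  -- on `T` is harmless, as `γ` does not charge it.
  set w : BorelProd X X → ℝ≥0∞ := fun p => (ENNReal.ofReal (1 - t p.fst : ℝ))⁻¹ with hw
  set A : Measure (Q × Q × unitInterval) :=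
    (γ.withDensity w).map G + (μ₀.restrict T).map G' with hA
  have hint : ∀ Φ : Q × Q × unitInterval → ℝ≥0∞, Measurable Φ →
      ∫⁻ q, Φ q ∂A = ∫⁻ p, w p * Φ (G p) ∂γ + ∫⁻ x in T, Φ (G' x) ∂μ₀ := by
    intro Φ hΦ
    rw [hA, lintegral_add_measure, lintegral_map hΦ mG, lintegral_map hΦ mG']
    congr 1
    exact lintegral_withDensity_eq_lintegral_mul γ mtfr (hΦ.comp mG)
  have hγη : ∀ ψ : X → ℝ≥0∞, Measurable ψ →
      ∫⁻ p, ψ p.fst ∂γ = ∫⁻ x, ENNReal.ofReal (1 - t x : ℝ) * ψ x ∂η := by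
    intro ψ hψ
    rw [← lintegral_map hψ mf, hfst, h1]
    exact lintegral_withDensity_eq_lintegral_mul η mtr hψ
  have hTη : ∀ ψ : X → ℝ≥0∞, Measurable ψ →
      ∫⁻ x in T, ψ x ∂μ₀ = ∫⁻ x, T.indicator ψ x ∂η := by
    intro ψ hψ
    rw [← lintegral_indicator mT, h0]
    refine (lintegral_withDensity_eq_lintegral_mul η (by fun_prop) (hψ.indicator mT)).trans ?_
    refine lintegral_congr fun x => ?_
    by_cases hx : x ∈ T
    · have hx' : (t x : ℝ) = 1 := hx
      simp [hx, hx']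
    · simp [hx]
  -- On `T` the first summand is `0 * (∞ * ψ x) = 0`, and the indicator supplies the missing `ψ x`.
  have hsplit : ∀ ψ : X → ℝ≥0∞, ∀ x, ENNReal.ofReal (1 - t x : ℝ) *
      ((ENNReal.ofReal (1 - t x : ℝ))⁻¹ * ψ x) + T.indicator ψ x = ψ x := by
    intro ψ x
    by_cases hx : x ∈ T
    · have hx' : (t x : ℝ) = 1 := hx
      simp [hx, hx']
    · have hx' : (t x : ℝ) < 1 := lt_of_le_of_ne (t x).2.2 hx
      have h2 : ENNReal.ofReal (1 - t x : ℝ) ≠ 0 := by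
        simpa using hx'
      rw [← mul_assoc, ENNReal.mul_inv_cancel h2 ENNReal.ofReal_ne_top, one_mul,
        indicator_of_notMem hx, add_zero]
  have hcomb : ∀ ψ : X → ℝ≥0∞, Measurable ψ →
      ∫⁻ p, w p * ψ p.fst ∂γ + ∫⁻ x in T, ψ x ∂μ₀ = ∫⁻ x, ψ x ∂η := by
    intro ψ hψ
    have m1 : Measurable fun x => (ENNReal.ofReal (1 - t x : ℝ))⁻¹ * ψ x := mtr.inv.mul hψ
    have m2 : Measurable fun x => ENNReal.ofReal (1 - t x : ℝ) *
        ((ENNReal.ofReal (1 - t x : ℝ))⁻¹ * ψ x) := mtr.mul m1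
    rw [hγη _ m1, hTη ψ hψ, ← lintegral_add_left m2]
    exact lintegral_congr fun x => hsplit ψ x
  refine ⟨A, fun φ hφ => ?_, fun φ hφ => ?_, fun κ hκ hle => ?_⟩
  · have mφ : Measurable fun x => φ (e x) := hφ.comp he
    have mψ : Measurable fun x => φ (e x) * ENNReal.ofReal (t x : ℝ) :=
      (hφ.comp he).mul (by fun_prop)
    have mΦ : Measurable fun q : Q × Q × unitInterval => φ q.1 * ENNReal.ofReal (q.2.2 : ℝ) :=
      (hφ.comp measurable_fst).mul (by fun_prop)
    rw [hint _ mΦ]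
    have e1 : ∫⁻ x in T, φ (G' x).1 * ENNReal.ofReal ((G' x).2.2 : ℝ) ∂μ₀ =
        ∫⁻ x in T, φ (e x) * ENNReal.ofReal (t x : ℝ) ∂μ₀ := by
      refine setLIntegral_congr_fun mT fun x hx => ?_
      have hx : (t x : ℝ) = 1 := hx
      simp [hG', hx]
    rw [e1]
    refine (hcomb _ mψ).trans ?_
    conv_rhs => rw [h0]
    rw [lintegral_withDensity_eq_lintegral_mul η (by fun_prop) mφ]
    exact lintegral_congr fun x => mul_comm _ _
  · have mφ : Measurable fun x => φ (e x) := hφ.comp he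
    have mΦ : Measurable fun q : Q × Q × unitInterval =>
        φ q.2.1 * ENNReal.ofReal (1 - q.2.2 : ℝ) :=
      (hφ.comp (measurable_fst.comp measurable_snd)).mul (by fun_prop)
    rw [hint _ mΦ]
    have e1 : ∫⁻ x in T, φ (G' x).2.1 * ENNReal.ofReal (1 - (G' x).2.2 : ℝ) ∂μ₀ = 0 := by
      simp [hG']
    have hlt : ∀ᵐ p ∂γ, (t p.fst : ℝ) < 1 := by
      have h2 : ∀ᵐ x ∂ν, (t x : ℝ) < 1 := by
        rw [h1, ae_withDensity_iff mtr]
        exact Filter.Eventually.of_forall fun x hx =>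
          sub_pos.1 (ENNReal.ofReal_pos.1 (pos_iff_ne_zero.2 hx))
      rw [← hfst] at h2
      exact ae_of_ae_map mf.aemeasurable h2
    rw [e1, add_zero, ← hsnd, lintegral_map mφ ms]
    refine lintegral_congr_ae ?_
    filter_upwards [hlt] with p hp
    have h2 : ENNReal.ofReal (1 - t p.fst : ℝ) ≠ 0 := by simpa using hp
    simp only [hw, hG]
    rw [mul_left_comm, ENNReal.inv_mul_cancel h2 ENNReal.ofReal_ne_top, mul_one]
  · set ψ : X → ℝ≥0∞ := fun x => ENNReal.ofReal ((√(t x : ℝ) - √(1 - t x : ℝ)) ^ 2) with hψd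
    have hψ : Measurable ψ := by fun_prop
    rw [hint _ (by fun_prop), hH, ← hcomb ψ hψ]
    have e1 : ∫⁻ x in T, ENNReal.ofReal ((√((G' x).2.2 : ℝ) - √(1 - (G' x).2.2 : ℝ)) ^ 2) +
        ENNReal.ofReal (1 - (G' x).2.2 : ℝ) * κ (G' x) ∂μ₀ = ∫⁻ x in T, ψ x ∂μ₀ := by
      refine setLIntegral_congr_fun mT fun x hx => ?_
      have hx : (t x : ℝ) = 1 := hx
      simp [hG', hψd, hx]
    rw [e1, add_right_comm]
    gcongr
    have mw : Measurable fun p : BorelProd X X => w p * ψ p.fst := mtfr.mul (hψ.comp mf)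
    rw [← lintegral_add_left mw]
    refine lintegral_mono fun p => ?_
    rw [mul_add, ← mul_assoc]
    gcongr
    calc w p * ENNReal.ofReal (1 - t p.fst : ℝ) * κ (G p)
        ≤ 1 * edist p.fst p.snd ^ 2 := by
          gcongr
          · exact ENNReal.inv_mul_le_one _
          · exact hle _ _ _
      _ = _ := one_mul _

end Lift

/-! ### Existence of optimal homogeneous couplings -/

section Existence

/-! ### Increasing continuous approximations of the cone cost -/

/-- Continuous functions on the compact model that increase to the squared distance. -/
def truncSqDist (m : ℕ) (q : DistPair) : ℝ≥0 :=
  -- This factor increases to the indicator of `r₀ > 0`: the cone cost charges no distance when `r₀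
  -- = 0`.
  Real.toNNReal (min 1 (m * (q.2.2 : ℝ))) *
    (Finset.range m).sup fun i => nndist (q.1 i) (q.2.1 i) ^ 2

theorem continuous_truncSqDist (m : ℕ) : Continuous (truncSqDist m) := by
  refine (continuous_real_toNNReal.comp (by fun_prop)).mul ?_
  refine Continuous.finset_sup_apply fun i _ => ?_
  fun_prop

theorem monotone_truncSqDist (q : DistPair) : Monotone fun m => truncSqDist m q := by
  intro m n hmn
  have := q.2.2.2.1
  refine mul_le_mul' (Real.toNNReal_mono ?_) (Finset.sup_mono (Finset.range_mono hmn))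
  gcongr

theorem truncSqDist_le {X : Type*} [MetricSpace X] (z : ℕ → X) (m : ℕ) (x y : X)
    (t : unitInterval) :
    (truncSqDist m (distCoord z x, distCoord z y, t) : ℝ≥0∞) ≤ edist x y ^ 2 := by
  rw [edist_nndist, ← ENNReal.coe_pow, ENNReal.coe_le_coe, ← one_mul (nndist x y ^ 2)]
  refine mul_le_mul' ?_ (Finset.sup_le fun i _ => ?_)
  · rw [Real.toNNReal_le_one]
    exact min_le_left _ _
  · exact pow_le_pow_left' (nndist_distCoord_le z x y i) 2

/-- Continuous functions on the compact model that increase to the cone cost. -/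
def truncCost (m : ℕ) : C(DistPair, ℝ≥0) where
  toFun q := Real.toNNReal ((√(q.2.2 : ℝ) - √(1 - q.2.2 : ℝ)) ^ 2) +
    Real.toNNReal (1 - q.2.2 : ℝ) * truncSqDist m q
  continuous_toFun := by
    have := continuous_truncSqDist m
    have h : Continuous Real.toNNReal := continuous_real_toNNReal
    exact (h.comp (by fun_prop)).add ((h.comp (by fun_prop)).mul this)

theorem coe_truncCost (m : ℕ) (q : DistPair) : (truncCost m q : ℝ≥0∞) =
    ENNReal.ofReal ((√(q.2.2 : ℝ) - √(1 - q.2.2 : ℝ)) ^ 2) +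
      ENNReal.ofReal (1 - q.2.2 : ℝ) * truncSqDist m q := by
  simp only [truncCost, ContinuousMap.coe_mk, ENNReal.coe_add, ENNReal.coe_mul]
  rfl

theorem monotone_truncCost : Monotone fun m (q : DistPair) => (truncCost m q : ℝ≥0∞) := by
  intro m n hmn q
  simp only [coe_truncCost]
  gcongr
  exact monotone_truncSqDist q hmn

theorem le_iSup_truncCost (q : DistPair) (h0 : 0 < (q.2.2 : ℝ)) :
    ENNReal.ofReal ((√(q.2.2 : ℝ) - √(1 - q.2.2 : ℝ)) ^ 2) +
      ENNReal.ofReal (1 - q.2.2 : ℝ) * ⨆ i, (nndist (q.1 i) (q.2.1 i) : ℝ≥0∞) ^ 2 ≤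
      ⨆ m, (truncCost m q : ℝ≥0∞) := by
  rw [ENNReal.mul_iSup, ENNReal.add_iSup]
  refine iSup_le fun i => ?_
  -- The index `k` saturates the factor `min 1 (m * t)`, while `i + 1` brings coordinate `i` into
  -- `Finset.range m`.
  obtain ⟨k, hk⟩ := exists_nat_gt (1 / (q.2.2 : ℝ))
  refine le_trans ?_ (le_iSup _ (max (i + 1) k))
  rw [coe_truncCost, ← ENNReal.coe_pow]
  gcongr
  have h1 : (1 : ℝ) ≤ (max (i + 1) k : ℕ) * (q.2.2 : ℝ) := by
    rw [div_lt_iff₀ h0] at hk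
    refine hk.le.trans ?_
    gcongr
    exact le_max_right _ _
  rw [truncSqDist, min_eq_left h1, Real.toNNReal_one, one_mul]
  exact Finset.le_sup (f := fun i => nndist (q.1 i) (q.2.1 i) ^ 2)
    (Finset.mem_range.2 (lt_of_lt_of_le (Nat.lt_succ_self i) (le_max_left _ _)))

/-! ### Weighted marginals of limit measures -/

/-- Weighted marginals pass to limits of measures. -/
theorem lintegral_weighted_marginal_of_tendsto {X Ω Q : Type*} [MeasurableSpace X]
    [TopologicalSpace Ω] [CompactSpace Ω] [MeasurableSpace Ω] [BorelSpace Ω]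
    [TopologicalSpace Q] [MeasurableSpace Q] [BorelSpace Q] [HasOuterApproxClosed Q]
    {μ : Measure X} {A : ℕ → Measure Ω} {B : Measure Ω} [IsFiniteMeasure B]
    (hB : ∀ f : C(Ω, ℝ≥0),
      Filter.Tendsto (fun n => ∫⁻ q, f q ∂A n) (Filter.hyperfilter ℕ) (𝓝 (∫⁻ q, f q ∂B)))
    {e : X → Q} (he : Measurable e) (p : C(Ω, Q)) (ρ : C(Ω, ℝ≥0))
    (hA : ∀ n, ∀ φ : Q → ℝ≥0∞, Measurable φ →
      ∫⁻ q, φ (p q) * ρ q ∂A n = ∫⁻ x, φ (e x) ∂μ)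
    {φ : Q → ℝ≥0∞} (hφ : Measurable φ) :
    ∫⁻ q, φ (p q) * ρ q ∂B = ∫⁻ x, φ (e x) ∂μ := by
  have mρ : Measurable fun q => (ρ q : ℝ≥0∞) := ρ.continuous.measurable.coe_nnreal_ennreal
  have mp : Measurable p := p.continuous.measurable
  have hint : ∀ φ : Q → ℝ≥0∞, Measurable φ →
      ∫⁻ x, φ x ∂((B.withDensity fun q => ρ q).map p) = ∫⁻ q, φ (p q) * ρ q ∂B := by
    intro φ hφ
    rw [lintegral_map hφ mp]
    refine (lintegral_withDensity_eq_lintegral_mul B mρ (hφ.comp mp)).trans ?_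
    exact lintegral_congr fun q => mul_comm _ _
  have hρ : ∫⁻ q, (ρ q : ℝ≥0∞) ∂B ≠ ⊤ := by
    obtain ⟨C, hC⟩ := isCompact_univ.bddAbove_image (f := ρ) ρ.continuous.continuousOn
    refine ne_top_of_le_ne_top (b := (C : ℝ≥0∞) * B univ) (by finiteness) ?_
    rw [← lintegral_const]
    exact lintegral_mono fun q => ENNReal.coe_le_coe.2 (hC ⟨q, mem_univ _, rfl⟩)
  have hfin := isFiniteMeasure_withDensity hρ
  have heq : (B.withDensity fun q => ρ q).map p = μ.map e := by
    refine ext_of_forall_lintegral_eq_of_IsFiniteMeasure fun f => ?_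
    have mf : Measurable fun x => (f x : ℝ≥0∞) := f.continuous.measurable.coe_nnreal_ennreal
    rw [hint _ mf, lintegral_map mf he]
    -- The test function `f (p q) * ρ q` is continuous, and its integrals along the sequence are
    -- constant.
    have h1 := hB ⟨fun q => f (p q) * ρ q, by fun_prop⟩
    simp only [ContinuousMap.coe_mk, ENNReal.coe_mul] at h1
    simp only [hA _ _ mf] at h1
    exact tendsto_nhds_unique h1 tendsto_const_nhds
  rw [← hint φ hφ, heq, lintegral_map hφ he]

/-- Testing with the indicator of `Sᶜ` gives integral zero. It locates the points of the limit where
their radius is positive, the only place where they matter. -/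
theorem ae_mem_of_lintegral_weighted_marginal {X Ω Q : Type*} [MeasurableSpace X]
    [MeasurableSpace Ω] [MeasurableSpace Q] {μ : Measure X} {B : Measure Ω} {e : X → Q}
    {p : Ω → Q} (hp : Measurable p) {ρ : Ω → ℝ≥0∞} (hρ : Measurable ρ)
    (hB : ∀ φ : Q → ℝ≥0∞, Measurable φ → ∫⁻ q, φ (p q) * ρ q ∂B = ∫⁻ x, φ (e x) ∂μ)
    {S : Set Q} (hS : MeasurableSet S) (hμ : ∀ᵐ x ∂μ, e x ∈ S) :
    ∀ᵐ q ∂B, ρ q ≠ 0 → p q ∈ S := by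
  have mi : Measurable (Sᶜ.indicator (1 : Q → ℝ≥0∞)) := measurable_one.indicator hS.compl
  have mi' : Measurable fun q => Sᶜ.indicator (1 : Q → ℝ≥0∞) (p q) * ρ q := (mi.comp hp).mul hρ
  have h := hB _ mi
  have h' : ∫⁻ x, Sᶜ.indicator (1 : Q → ℝ≥0∞) (e x) ∂μ = 0 := by
    refine lintegral_eq_zero_of_ae_eq_zero ?_
    filter_upwards [hμ] with x hx
    exact indicator_of_notMem (notMem_compl_iff.2 hx) _
  rw [h', lintegral_eq_zero_iff mi'] at h
  filter_upwards [h] with q hq ht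
  by_contra hn
  rw [indicator_of_mem (show p q ∈ Sᶜ from hn)] at hq
  simp [ht] at hq

/-! ### The direct method on the compact model -/

variable {X : Type*} [MetricSpace X] [MeasurableSpace X]

theorem exists_intermediate_coupling_lt {μ₀ μ₁ : Measure X} {c : ℝ≥0∞} (hc : WHe μ₀ μ₁ < c) :
    ∃ ν : Measure X, IsFiniteRadon ν ∧ ∃ γ ∈ Couplings ν μ₁,
      hellinger μ₀ ν ^ 2 + ∫⁻ p, edist p.fst p.snd ^ 2 ∂γ < c := by
  simp only [WHe, iInf_lt_iff] at hc
  obtain ⟨ν, hν, h⟩ := hc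
  rw [wasserstein_sq, ← lt_tsub_iff_left] at h
  simp only [iInf_lt_iff] at h
  obtain ⟨γ, hγ, h⟩ := h
  exact ⟨ν, hν, γ, hγ, lt_tsub_iff_left.1 h⟩

theorem isWHeMinimizer_of_eq {μ₀ μ₁ ν : Measure X} (hν : IsFiniteRadon ν) {c : ℝ≥0∞}
    (h : hellinger μ₀ ν ^ 2 + wasserstein ν μ₁ ^ 2 = c) (hc : c ≤ WHe μ₀ μ₁) :
    WHe μ₀ μ₁ = c ∧ IsWHeMinimizer μ₀ μ₁ ν := by
  have hle : WHe μ₀ μ₁ ≤ c := h ▸ iInf₂_le ν hν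
  exact ⟨le_antisymm hle hc, hν, h.trans (le_antisymm hc hle)⟩

variable [BorelSpace X]

/-- Compactness comes from the model, not from tightness of the intermediate measures: only the
fixed marginals `μ₀` and `μ₁` are needed to bring the limit back to `X`. -/
theorem exists_homCoupling_lintegral_le (xbar : X) {μ₀ μ₁ : Measure X} (h₀ : IsFiniteRadon μ₀)
    (h₁ : IsFiniteRadon μ₁) (hfin : WHe μ₀ μ₁ ≠ ⊤) :
    ∃ α ∈ HomCouplings xbar μ₀ μ₁, ∫⁻ z, wheCost xbar z ∂α ≤ WHe μ₀ μ₁ := by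
  have := h₀.finite
  have := h₁.finite
  obtain ⟨K, hK, -, hKnull⟩ := (h₀.add h₁).exists_isCompact_diff_null MeasurableSet.univ
  set Y := ⋃ n, K n with hY
  have hY₀ : ∀ᵐ x ∂μ₀, x ∈ Y := by
    rw [Measure.add_apply, add_eq_zero] at hKnull
    filter_upwards [measure_eq_zero_iff_ae_notMem.1 hKnull.1] with x hx
    simpa using hx
  have hY₁ : ∀ᵐ x ∂μ₁, x ∈ Y := by
    rw [Measure.add_apply, add_eq_zero] at hKnull
    filter_upwards [measure_eq_zero_iff_ae_notMem.1 hKnull.2] with x hx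
    simpa using hx
  -- `xbar` is added because `Y` may be empty.
  have hsep : TopologicalSpace.IsSeparable (Y ∪ {xbar}) :=
    (TopologicalSpace.isSeparable_iUnion.2 fun n => (hK n).isSeparable).union
      isCompact_singleton.isSeparable
  obtain ⟨z, hz⟩ := exists_seq_frequently_dist_lt hsep ⟨xbar, Or.inr rfl⟩
  set e := distCoord z with he
  have hec : Continuous e := continuous_distCoord z
  have hem : Measurable e := hec.measurable
  have hinj : InjOn e Y := fun x hx y _ h => eq_of_distCoord_eq (hz x (Or.inl hx)) h
  obtain ⟨s, P, hse, hPm, hPc, hsc⟩ :=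
    exists_piecewise_continuous_leftInverse xbar hec hK hinj
  have hsm : Measurable s := measurable_of_continuousOn_cover hPm hPc hsc
  have heY : MeasurableSet (e '' Y) := by
    rw [hY, image_iUnion]
    exact MeasurableSet.iUnion fun n => ((hK n).image hec).isClosed.measurableSet
  -- lifts of a minimizing sequence
  have hseq : ∀ n : ℕ, ∃ A : Measure DistPair,
      (∀ φ : DistBox → ℝ≥0∞, Measurable φ →
        ∫⁻ q, φ q.1 * ENNReal.ofReal (q.2.2 : ℝ) ∂A = ∫⁻ x, φ (e x) ∂μ₀) ∧
      (∀ φ : DistBox → ℝ≥0∞, Measurable φ →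
        ∫⁻ q, φ q.2.1 * ENNReal.ofReal (1 - q.2.2 : ℝ) ∂A = ∫⁻ x, φ (e x) ∂μ₁) ∧
      ∀ m, ∫⁻ q, truncCost m q ∂A ≤ WHe μ₀ μ₁ + ((n : ℝ≥0∞) + 1)⁻¹ := by
    intro n
    obtain ⟨ν, hν, γ, hγ, hlt⟩ := exists_intermediate_coupling_lt
      (ENNReal.lt_add_right hfin (ENNReal.inv_ne_zero.2 (by finiteness) :
        ((n : ℝ≥0∞) + 1)⁻¹ ≠ 0))
    have := hν.finite
    obtain ⟨A, hA₀, hA₁, hA⟩ := exists_lift (μ₀ := μ₀) hγ hem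
    refine ⟨A, hA₀, hA₁, fun m => le_trans ?_ hlt.le⟩
    simp only [coe_truncCost]
    exact hA (fun q => truncSqDist m q)
      (continuous_truncSqDist m).measurable.coe_nnreal_ennreal fun x y t => truncSqDist_le z m x y t
  choose A hA₀ hA₁ hA using hseq
  -- Testing both marginals with `1` and adding gives the mass, since the squared radii sum to `1`.
  have hmass : ∀ n, A n univ ≤ μ₀ univ + μ₁ univ := by
    intro n
    have e₀ := hA₀ n (fun _ => 1) measurable_const
    have e₁ := hA₁ n (fun _ => 1) measurable_const
    simp only [one_mul, lintegral_one] at e₀ e₁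
    rw [← e₀, ← e₁, ← lintegral_add_left (by fun_prop), ← lintegral_one]
    exact (lintegral_congr fun q : DistPair => (ofReal_add_ofReal_one_sub q.2.2).symm).le
  obtain ⟨B, hBfin, hB⟩ := exists_ultrafilter_limit A (by finiteness) hmass
  have hB₀ : ∀ φ : DistBox → ℝ≥0∞, Measurable φ →
      ∫⁻ q, φ q.1 * ENNReal.ofReal (q.2.2 : ℝ) ∂B = ∫⁻ x, φ (e x) ∂μ₀ := fun φ hφ =>
    lintegral_weighted_marginal_of_tendsto hB hem ⟨fun q => q.1, continuous_fst⟩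
      ⟨fun q => Real.toNNReal q.2.2, continuous_real_toNNReal.comp (by fun_prop)⟩ hA₀ hφ
  have hB₁ : ∀ φ : DistBox → ℝ≥0∞, Measurable φ →
      ∫⁻ q, φ q.2.1 * ENNReal.ofReal (1 - q.2.2 : ℝ) ∂B = ∫⁻ x, φ (e x) ∂μ₁ := fun φ hφ =>
    lintegral_weighted_marginal_of_tendsto hB hem ⟨fun q => q.2.1, by fun_prop⟩
      ⟨fun q => Real.toNNReal (1 - q.2.2), continuous_real_toNNReal.comp (by fun_prop)⟩ hA₁ hφ
  -- The index `m` stays fixed while the sequence converges; the supremum over `m` is taken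
  -- afterwards.
  have hBcost : ∀ m, ∫⁻ q, truncCost m q ∂B ≤ WHe μ₀ μ₁ := by
    intro m
    have hlim : Filter.Tendsto (fun n : ℕ => WHe μ₀ μ₁ + ((n : ℝ≥0∞) + 1)⁻¹) Filter.atTop
        (𝓝 (WHe μ₀ μ₁ + 0)) := by
      refine tendsto_const_nhds.add ?_
      simpa using (Filter.tendsto_add_atTop_iff_nat 1).2 ENNReal.tendsto_inv_nat_nhds_zero
    rw [add_zero] at hlim
    exact le_of_tendsto_of_tendsto' (hB (truncCost m))
      (hlim.mono_left Nat.hyperfilter_le_atTop) fun n => hA n m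
  -- pulling the limit back to the cone
  set r₀ : DistPair → ℝ≥0 := fun q => NNReal.sqrt (Real.toNNReal q.2.2) with hr₀
  set r₁ : DistPair → ℝ≥0 := fun q => NNReal.sqrt (Real.toNNReal (1 - q.2.2)) with hr₁
  have hr₀c : Continuous r₀ :=
    NNReal.continuous_sqrt.comp (continuous_real_toNNReal.comp (by fun_prop))
  have hr₁c : Continuous r₁ :=
    NNReal.continuous_sqrt.comp (continuous_real_toNNReal.comp (by fun_prop))
  have hr₀sq : ∀ q, (r₀ q : ℝ≥0∞) ^ 2 = ENNReal.ofReal (q.2.2 : ℝ) := fun q => by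
    rw [hr₀, ← ENNReal.coe_pow, NNReal.sq_sqrt]; rfl
  have hr₁sq : ∀ q, (r₁ q : ℝ≥0∞) ^ 2 = ENNReal.ofReal (1 - q.2.2 : ℝ) := fun q => by
    rw [hr₁, ← ENNReal.coe_pow, NNReal.sq_sqrt]; rfl
  set F : DistPair → PCone X := fun q =>
    BorelProd.mk (Cone.mk (s q.1) (r₀ q)) (Cone.mk (s q.2.1) (r₁ q)) with hF
  set D : Option ℕ × Option ℕ → Set DistPair := fun i => {q | q.1 ∈ P i.1 ∧ q.2.1 ∈ P i.2} with hD
  have hDm : ∀ i, MeasurableSet (D i) := fun i =>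
    (measurable_fst (hPm i.1)).inter ((measurable_fst.comp measurable_snd) (hPm i.2))
  have hDc : ∀ q, ∃ i, q ∈ D i := by
    intro q
    obtain ⟨i, hi⟩ := hPc q.1
    obtain ⟨j, hj⟩ := hPc q.2.1
    exact ⟨(i, j), hi, hj⟩
  have hFc : ∀ i, ContinuousOn F (D i) := by
    intro i
    have c₀ : ContinuousOn (fun q : DistPair => s q.1) (D i) :=
      (hsc i.1).comp continuous_fst.continuousOn fun q hq => hq.1
    have c₁ : ContinuousOn (fun q : DistPair => s q.2.1) (D i) :=
      (hsc i.2).comp (continuous_fst.comp continuous_snd).continuousOn fun q hq => hq.2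
    exact BorelProd.continuousOn_mk
      (Cone.continuous_mk.comp_continuousOn (c₀.prodMk hr₀c.continuousOn))
      (Cone.continuous_mk.comp_continuousOn (c₁.prodMk hr₁c.continuousOn))
  have hFm : Measurable F := measurable_of_continuousOn_cover hDm hDc hFc
  have hBR : IsFiniteRadon B := ⟨hBfin, inferInstance⟩
  have mr₀ : Measurable fun z : PCone X => (z.fst.radius : ℝ≥0∞) ^ 2 :=
    continuous_radius_fst.measurable.coe_nnreal_ennreal.pow_const 2
  have mr₁ : Measurable fun z : PCone X => (z.snd.radius : ℝ≥0∞) ^ 2 :=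
    continuous_radius_snd.measurable.coe_nnreal_ennreal.pow_const 2
  have mx₀ : Measurable fun z : PCone X => z.fst.pos xbar :=
    (Cone.measurable_pos xbar).comp BorelProd.continuous_fst.measurable
  have mx₁ : Measurable fun z : PCone X => z.snd.pos xbar :=
    (Cone.measurable_pos xbar).comp BorelProd.continuous_snd.measurable
  refine ⟨B.map F, ⟨hBR.map_of_continuousOn_cover hDm hDc hFc, ?_, ?_, ?_⟩, ?_⟩
  · have mr : Measurable fun z : PCone X =>
        (z.fst.radius : ℝ≥0∞) ^ 2 + (z.snd.radius : ℝ≥0∞) ^ 2 := mr₀.add mr₁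
    rw [lintegral_map mr hFm]
    simp only [hF, BorelProd.fst_mk, BorelProd.snd_mk, Cone.radius_mk, hr₀sq, hr₁sq,
      ofReal_add_ofReal_one_sub, lintegral_one]
    exact measure_lt_top B univ
  · refine Measure.ext_of_lintegral _ fun f hf => ?_
    have mf : Measurable fun z : PCone X => f (z.fst.pos xbar) := hf.comp mx₀
    rw [homMarginal₀, lintegral_map hf mx₀, lintegral_withDensity_eq_lintegral_mul _ mr₀ mf,
      lintegral_map (mr₀.mul mf) hFm]
    have e₀ : ∫⁻ x, f x ∂μ₀ = ∫⁻ x, f (s (e x)) ∂μ₀ := by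
      refine lintegral_congr_ae ?_
      filter_upwards [hY₀] with x hx
      rw [hse x hx]
    rw [e₀]
    refine Eq.trans ?_ (hB₀ _ (hf.comp hsm))
    refine lintegral_congr fun q => ?_
    simp only [hF, Pi.mul_apply, BorelProd.fst_mk, Cone.radius_mk, hr₀sq, Cone.pos_mk,
      Function.comp_apply]
    rw [mul_comm]
    -- At the vertex the position becomes `xbar` instead of `s q.1`, but there the weight is zero.
    rcases eq_or_ne (r₀ q) 0 with h | h
    · rw [← hr₀sq, h]
      simp
    · rw [if_pos (pos_iff_ne_zero.2 h)]
  · refine Measure.ext_of_lintegral _ fun f hf => ?_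
    have mf : Measurable fun z : PCone X => f (z.snd.pos xbar) := hf.comp mx₁
    rw [homMarginal₁, lintegral_map hf mx₁, lintegral_withDensity_eq_lintegral_mul _ mr₁ mf,
      lintegral_map (mr₁.mul mf) hFm]
    have e₁ : ∫⁻ x, f x ∂μ₁ = ∫⁻ x, f (s (e x)) ∂μ₁ := by
      refine lintegral_congr_ae ?_
      filter_upwards [hY₁] with x hx
      rw [hse x hx]
    rw [e₁]
    refine Eq.trans ?_ (hB₁ _ (hf.comp hsm))
    refine lintegral_congr fun q => ?_
    simp only [hF, Pi.mul_apply, BorelProd.snd_mk, Cone.radius_mk, hr₁sq, Cone.pos_mk,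
      Function.comp_apply]
    rw [mul_comm]
    rcases eq_or_ne (r₁ q) 0 with h | h
    · rw [← hr₁sq, h]
      simp
    · rw [if_pos (pos_iff_ne_zero.2 h)]
  · have ae₀ : ∀ᵐ q ∂B, 0 < (q.2.2 : ℝ) → q.1 ∈ e '' Y := by
      filter_upwards [ae_mem_of_lintegral_weighted_marginal measurable_fst (by fun_prop) hB₀ heY
        (hY₀.mono fun x hx => mem_image_of_mem e hx)] with q hq ht
      exact hq (ENNReal.ofReal_pos.2 ht).ne'
    have ae₁ : ∀ᵐ q ∂B, (q.2.2 : ℝ) < 1 → q.2.1 ∈ e '' Y := by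
      filter_upwards [ae_mem_of_lintegral_weighted_marginal (measurable_fst.comp measurable_snd)
        (by fun_prop) hB₁ heY (hY₁.mono fun x hx => mem_image_of_mem e hx)] with q hq ht
      exact hq (ENNReal.ofReal_pos.2 (sub_pos.2 ht)).ne'
    refine (lintegral_map_le _ _).trans ?_
    calc ∫⁻ q, wheCost xbar (F q) ∂B ≤ ∫⁻ q, ⨆ m, (truncCost m q : ℝ≥0∞) ∂B := by
          refine lintegral_mono_ae ?_
          filter_upwards [ae₀, ae₁] with q hq₀ hq₁
          have hval : wheCost xbar (F q) =
              ENNReal.ofReal ((√(q.2.2 : ℝ) - √(1 - q.2.2 : ℝ)) ^ 2) +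
                if 0 < r₀ q then ENNReal.ofReal (1 - q.2.2 : ℝ) *
                  edist (s q.1) ((F q).snd.pos xbar) ^ 2 else 0 := by
            simp only [wheCost, hF, BorelProd.fst_mk, BorelProd.snd_mk, Cone.radius_mk, hr₁sq]
            congr 1
            · simp only [hr₀, hr₁, Real.coe_sqrt, Real.coe_toNNReal _ q.2.2.2.1,
                Real.coe_toNNReal _ (sub_nonneg.2 q.2.2.2.2)]
            · by_cases h : 0 < r₀ q
              · rw [if_pos h, if_pos h, Cone.pos_mk, if_pos h]
              · rw [if_neg h, if_neg h]
          have hle : ENNReal.ofReal ((√(q.2.2 : ℝ) - √(1 - q.2.2 : ℝ)) ^ 2) ≤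
              ⨆ m, (truncCost m q : ℝ≥0∞) := by
            refine le_trans ?_ (le_iSup _ 0)
            rw [coe_truncCost]
            exact le_self_add
          rw [hval]
          split_ifs with h
          · have ht : 0 < (q.2.2 : ℝ) := by simpa [hr₀] using h
            -- If `t = 1` the second point may lie outside `e '' Y`, but its distance term has
            -- coefficient `1 - t = 0`.
            rcases q.2.2.2.2.eq_or_lt with h1 | h1
            · rw [h1] at hle ⊢
              simpa using hle
            · obtain ⟨x, hx, hxe⟩ := hq₀ ht
              obtain ⟨y, hy, hye⟩ := hq₁ h1
              have hr₁p : 0 < r₁ q := by simpa [hr₁] using h1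
              refine le_trans ?_ (le_iSup_truncCost q ht)
              gcongr
              simp only [hF, BorelProd.snd_mk, Cone.pos_mk, if_pos hr₁p]
              rw [← hxe, ← hye, hse x hx, hse y hy]
              exact edist_sq_le_iSup_distCoord (hz x (Or.inl hx)) y
          · simpa using hle
      _ = ⨆ m, ∫⁻ q, truncCost m q ∂B := by
          refine lintegral_iSup (fun m => ?_) monotone_truncCost
          exact (truncCost m).continuous.measurable.coe_nnreal_ennreal
      _ ≤ WHe μ₀ μ₁ := iSup_le hBcost

/-! ### Finiteness, attainment and null measures -/

theorem WHe_le_measure_add {μ₀ μ₁ : Measure X} (h₀ : IsFiniteRadon μ₀) (h₁ : IsFiniteRadon μ₁) :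
    WHe μ₀ μ₁ ≤ μ₀ univ + μ₁ univ := by
  have := h₀.finite
  have := h₁.finite
  refine (iInf₂_le μ₁ h₁).trans ?_
  rw [wasserstein_sq_self h₁, add_zero]
  exact hellinger_sq_le μ₀ μ₁

theorem WHe_lt_top {μ₀ μ₁ : Measure X} (h₀ : IsFiniteRadon μ₀) (h₁ : IsFiniteRadon μ₁) :
    WHe μ₀ μ₁ < ⊤ := by
  have := h₀.finite
  have := h₁.finite
  exact (WHe_le_measure_add h₀ h₁).trans_lt (by finiteness)

theorem WHe_le_lintegral {xbar : X} {μ₀ μ₁ : Measure X} {α : Measure (PCone X)}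
    (hα : α ∈ HomCouplings xbar μ₀ μ₁) : WHe μ₀ μ₁ ≤ ∫⁻ z, wheCost xbar z ∂α := by
  obtain ⟨ν, hν, h⟩ := HomCouplings.exists_intermediate hα
  exact (iInf₂_le ν hν).trans h

theorem exists_homCoupling_eq (xbar : X) {μ₀ μ₁ : Measure X} (h₀ : IsFiniteRadon μ₀)
    (h₁ : IsFiniteRadon μ₁) :
    ∃ α ∈ HomCouplings xbar μ₀ μ₁, WHe μ₀ μ₁ = ∫⁻ z, wheCost xbar z ∂α := by
  obtain ⟨α, hα, h⟩ := exists_homCoupling_lintegral_le xbar h₀ h₁ (WHe_lt_top h₀ h₁).ne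
  exact ⟨α, hα, le_antisymm (WHe_le_lintegral hα) h⟩

theorem WHe_eq_UOT (xbar : X) {μ₀ μ₁ : Measure X} (h₀ : IsFiniteRadon μ₀)
    (h₁ : IsFiniteRadon μ₁) : WHe μ₀ μ₁ = UOT xbar (wheCost xbar) μ₀ μ₁ := by
  obtain ⟨α, hα, h⟩ := exists_homCoupling_eq xbar h₀ h₁
  exact le_antisymm (le_iInf₂ fun β hβ => WHe_le_lintegral hβ) (h ▸ iInf₂_le α hα)

/-- The intermediate measure of an optimal coupling costs no more than the coupling, that is, no
more than the infimum. -/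
theorem exists_isWHeMinimizer (xbar : X) {μ₀ μ₁ : Measure X} (h₀ : IsFiniteRadon μ₀)
    (h₁ : IsFiniteRadon μ₁) : ∃ ν, IsWHeMinimizer μ₀ μ₁ ν := by
  obtain ⟨α, hα, h⟩ := exists_homCoupling_eq xbar h₀ h₁
  obtain ⟨ν, hν, hle⟩ := HomCouplings.exists_intermediate hα
  exact ⟨ν, hν, le_antisymm (hle.trans h.ge) (iInf₂_le ν hν)⟩

/-- The intermediate measures of finite cost have the mass of the second measure. -/
theorem le_WHe_of_forall {μ₀ μ₁ : Measure X} {c : ℝ≥0∞}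
    (h : ∀ ν, IsFiniteRadon ν → ν univ = μ₁ univ → c ≤ hellinger μ₀ ν ^ 2) : c ≤ WHe μ₀ μ₁ := by
  refine le_of_forall_gt fun d hd => ?_
  obtain ⟨ν, hν, γ, hγ, hlt⟩ := exists_intermediate_coupling_lt hd
  exact (h ν hν (Couplings.measure_univ_eq hγ)).trans_lt (le_self_add.trans_lt hlt)

theorem WHe_zero_left {μ₁ : Measure X} (h₁ : IsFiniteRadon μ₁) :
    WHe 0 μ₁ = μ₁ univ ∧ IsWHeMinimizer 0 μ₁ μ₁ := by
  have := h₁.finite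
  refine isWHeMinimizer_of_eq h₁ ?_ (le_WHe_of_forall fun ν hν hm => ?_)
  · rw [wasserstein_sq_self h₁, add_zero, hellinger_sq_zero_left]
  · have := hν.finite
    -- Against the null measure, the squared Hellinger distance depends only on the mass of `ν`,
    -- which is prescribed.
    rw [hellinger_sq_zero_left, hm]

theorem WHe_zero_right {μ₀ : Measure X} (h₀ : IsFiniteRadon μ₀) :
    WHe μ₀ 0 = μ₀ univ ∧ IsWHeMinimizer μ₀ 0 0 := by
  have := h₀.finite
  have hz : hellinger μ₀ 0 ^ 2 = μ₀ univ := by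
    rw [hellinger_sq_comm, hellinger_sq_zero_left]
  refine isWHeMinimizer_of_eq IsFiniteRadon.zero ?_ (le_WHe_of_forall fun ν hν hm => ?_)
  · rw [wasserstein_sq_self IsFiniteRadon.zero, add_zero, hz]
  -- Zero mass leaves `ν = 0` as the only competitor.
  · rw [Measure.measure_univ_eq_zero.1 (hm.trans (by simp)), hz]

end Existence

end

theorem proposition5p2 {X : Type*} [MetricSpace X] [MeasurableSpace X] [BorelSpace X]
    (xbar : X) :
    -- finiteness
    (∀ μ₀ μ₁ : Measure X, IsFiniteRadon μ₀ → IsFiniteRadon μ₁ → WHe μ₀ μ₁ < ⊤) ∧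
    -- the value, and a minimizer, when one of the two measures is null
    ((∀ μ₁ : Measure X, IsFiniteRadon μ₁ →
        WHe 0 μ₁ = μ₁ univ ∧ IsWHeMinimizer 0 μ₁ μ₁) ∧
      (∀ μ₀ : Measure X, IsFiniteRadon μ₀ →
        WHe μ₀ 0 = μ₀ univ ∧ IsWHeMinimizer μ₀ 0 0)) ∧
    -- the cone cost is well defined and induces the marginal problem
    ((∃! H : PCone X → ℝ≥0∞, IsWHeCost H) ∧
      ∀ H : PCone X → ℝ≥0∞, IsWHeCost H →
        (∀ z, H z < ⊤) ∧ IsProperCost H ∧ LowerSemicontinuous H ∧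
        IsRadiallyTwoHomogeneous H ∧
        (∀ μ₀ μ₁ : Measure X, IsFiniteRadon μ₀ → IsFiniteRadon μ₁ →
          WHe μ₀ μ₁ = UOT xbar H μ₀ μ₁) ∧
        (∀ μ₀ μ₁ : Measure X, IsFiniteRadon μ₀ → IsFiniteRadon μ₁ →
          ∃ α ∈ HomCouplings xbar μ₀ μ₁, WHe μ₀ μ₁ = ∫⁻ z, H z ∂α)) ∧
    -- existence of minimizers
    (∀ μ₀ μ₁ : Measure X, IsFiniteRadon μ₀ → IsFiniteRadon μ₁ →
      ∃ ν : Measure X, IsWHeMinimizer μ₀ μ₁ ν) := by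
  refine ⟨fun μ₀ μ₁ h₀ h₁ => WHe_lt_top h₀ h₁, ⟨fun μ₁ h₁ => WHe_zero_left h₁,
    fun μ₀ h₀ => WHe_zero_right h₀⟩, ⟨⟨wheCost xbar, isWHeCost_wheCost xbar,
    fun H hH => hH.eq_wheCost xbar⟩, fun H hH => ?_⟩,
    fun μ₀ μ₁ h₀ h₁ => exists_isWHeMinimizer xbar h₀ h₁⟩
  have hhom := hH.isRadiallyTwoHomogeneous
  obtain rfl := hH.eq_wheCost xbar
  exact ⟨wheCost_lt_top xbar, ⟨.mk (.mk xbar 0) (.mk xbar 0), wheCost_lt_top xbar _⟩,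
    lowerSemicontinuous_wheCost xbar, hhom, fun μ₀ μ₁ h₀ h₁ => WHe_eq_UOT xbar h₀ h₁,
    fun μ₀ μ₁ h₀ h₁ => exists_homCoupling_eq xbar h₀ h₁⟩
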